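/- Let $k$ be a commutative ring and let $A$ be an associative unital $k$-algebra which is symmetric, i.e. there is an isomorphism of $A$-bimodules $A\cong A^*:=\mathrm{Hom}_k(A,k)$, where $(b\cdot\varphi\cdot c)(x)=\varphi(cxb)$. Let $C^n(A,A)=\mathrm{Hom}_k(A^{\otimes n},A)$, $n\ge 0$, be the Hochschild cochain complex, with differential $$(\delta f)(a_1,\dots,a_{n+1})=a_1f(a_2,\dots,a_{n+1})+\sum_{i=1}^n(-1)^if(a_1,\dots,a_ia_{i+1},\dots,a_{n+1})+(-1)^{n+1}f(a_1,\dots,a_n)a_{n+1},$$ and let $H^\bullet(A,A)$ be its cohomology. For $f\in C^p(A,A)$ and $g\in C^q(A,A)$ put $$(f\smile g)(a_1,\dots,a_{p+q})=f(a_1,\dots,a_p)\,g(a_{p+1},\dots,a_{p+q}),$$ $$(f\circ_ig)(a_1,\dots,a_{p+q-1})=f(a_1,\dots,a_{i-1},g(a_i,\dots,a_{i+q-1}),a_{i+q},\dots,a_{p+q-1}),$$ $$f\mathbin{\bar\circ}g=(-1)^{(p-1)(q-1)}\sum_{i=1}^p(-1)^{(q-1)(i-1)}f\circ_ig,\qquad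 \{f,g\}=f\mathbin{\bar\circ}g-(-1)^{(p-1)(q-1)}g\mathbin{\bar\circ}f .$$ Then the cup product $\smile$, with unit the class of $1\in A=C^0(A,A)$, and the Gerstenhaber bracket $\{\cdot,\cdot\}$ are well defined on $H^\bullet(A,A)$ and are part of the structure of a Batalin–Vilkovisky algebra over $k$ on $H^\bullet(A,A)$, that is: (i) $\smile$ makes $H^\bullet(A,A)$ a graded associative unital $k$-algebra with $\alpha\smile\beta=(-1)^{pq}\beta\smile\alpha$ for $\alpha\in H^p(A,A)$, $\beta\in H^q(A,A)$; (ii) $\{\cdot,\cdot\}$ maps $H^p(A,A)\times H^q(A,A)$ to $H^{p+q-1}(A,A)$ (with $H^{-1}(A,A)=0$) and is a graded Lie bracket for the shifted degree $p-1$: for $\alpha\in H^p(A,A)$, $\beta\in H^q(A,A)$ and all $\zeta$ one has $\{\alpha,\beta\}=-(-1)^{(p-1)(q-1)}\{\beta,\alpha\}$ and $\{\alpha,\{\beta,\zeta\}\}=\{\{\alpha,\beta\},\zeta\}+(-1)^{(p-1)(q-1)}\{\beta,\{\alpha,\zeta\}\}$, as well as $\{\alpha,\alpha\}=0$ if $p$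 is odd and $\{\alpha,\{\alpha,\alpha\}\}=0$ if $p$ is even; (iii) $\{\gamma,\alpha\smile\beta\}=\{\gamma,\alpha\}\smile\beta+(-1)^{(p-1)q}\alpha\smile\{\gamma,\beta\}$ for $\gamma\in H^p(A,A)$, $\alpha\in H^q(A,A)$ and all $\beta$; (iv) there is a $k$-linear map $B:H^n(A,A)\to H^{n-1}(A,A)$ ($n\ge 0$) with $B\circ B=0$ such that, for all $\alpha\in H^p(A,A)$ and all $\beta$, $$\{\alpha,\beta\}=(-1)^p\bigl(B(\alpha\smile\beta)-B(\alpha)\smile\beta-(-1)^p\alpha\smile B(\beta)\bigr).$$ -/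

import Mathlib

open scoped DirectSum

/-! ### Gerstenhaber and Batalin-Vilkovisky algebras -/

/-- A Gerstenhaber algebra structure over `k` on the graded `k`-module `V = ⨁ p, V p`.
An element of `V p` is placed in the total module `⨁ p, V p` by `DirectSum.lof k ℕ V p`.
The bracket has degree `-1`; with respect to the shifted degree `p - 1` (which has the parity
of `p + 1`) it is a graded Lie bracket. -/
structure GerstenhaberAlgebra (k : Type*) [CommRing k] (V : ℕ → Type*)
    [∀ p, AddCommGroup (V p)] [∀ p, Module k (V p)] where
  /-- the product `x ⌣ y` -/
  mul : (⨁ p, V p) →ₗ[k] (⨁ p, V p) →ₗ[k] (⨁ p, V p)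
  /-- the unit of the product -/
  one : ⨁ p, V p
  /-- the bracket `{x, y}` -/
  bracket : (⨁ p, V p) →ₗ[k] (⨁ p, V p) →ₗ[k] (⨁ p, V p)
  one_mem : one ∈ LinearMap.range (DirectSum.lof k ℕ V 0)
  mul_mem : ∀ (p q : ℕ) (a : V p) (b : V q),
    mul (DirectSum.lof k ℕ V p a) (DirectSum.lof k ℕ V q b) ∈
      LinearMap.range (DirectSum.lof k ℕ V (p + q))
  one_mul : ∀ x, mul one x = x
  mul_one : ∀ x, mul x one = x
  mul_assoc : ∀ x y z, mul (mul x y) z = mul x (mul y z)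
  mul_comm : ∀ (p q : ℕ) (a : V p) (b : V q),
    mul (DirectSum.lof k ℕ V p a) (DirectSum.lof k ℕ V q b) =
      (-1 : k) ^ (p * q) • mul (DirectSum.lof k ℕ V q b) (DirectSum.lof k ℕ V p a)
  bracket_mem : ∀ (p q n : ℕ), p + q = n + 1 → ∀ (a : V p) (b : V q),
    bracket (DirectSum.lof k ℕ V p a) (DirectSum.lof k ℕ V q b) ∈
      LinearMap.range (DirectSum.lof k ℕ V n)
  /-- the bracket of two elements of degree `0` lies in degree `-1`, hence vanishes -/
  bracket_zero_zero : ∀ a b : V 0,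
    bracket (DirectSum.lof k ℕ V 0 a) (DirectSum.lof k ℕ V 0 b) = 0
  bracket_skew : ∀ (p q : ℕ) (a : V p) (b : V q),
    bracket (DirectSum.lof k ℕ V p a) (DirectSum.lof k ℕ V q b) =
      -((-1 : k) ^ ((p + 1) * (q + 1)) •
        bracket (DirectSum.lof k ℕ V q b) (DirectSum.lof k ℕ V p a))
  /-- follows from skew-symmetry if `2` is invertible in `k` -/
  bracket_self : ∀ (p : ℕ), Odd p → ∀ a : V p,
    bracket (DirectSum.lof k ℕ V p a) (DirectSum.lof k ℕ V p a) = 0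
  jacobi : ∀ (p q : ℕ) (a : V p) (b : V q) (z : ⨁ p, V p),
    bracket (DirectSum.lof k ℕ V p a) (bracket (DirectSum.lof k ℕ V q b) z) =
      bracket (bracket (DirectSum.lof k ℕ V p a) (DirectSum.lof k ℕ V q b)) z +
        (-1 : k) ^ ((p + 1) * (q + 1)) •
          bracket (DirectSum.lof k ℕ V q b) (bracket (DirectSum.lof k ℕ V p a) z)
  /-- follows from the Jacobi identity if `3` is invertible in `k` -/
  jacobi_self : ∀ (p : ℕ), Even p → ∀ a : V p,
    bracket (DirectSum.lof k ℕ V p a)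
      (bracket (DirectSum.lof k ℕ V p a) (DirectSum.lof k ℕ V p a)) = 0
  /-- the graded Leibniz rule
  `{c, a ⌣ y} = {c, a} ⌣ y + (-1) ^ ((p - 1) * q) a ⌣ {c, y}` for `c` of degree `p`, `a` of
  degree `q` -/
  leibniz : ∀ (p q : ℕ) (c : V p) (a : V q) (y : ⨁ p, V p),
    bracket (DirectSum.lof k ℕ V p c) (mul (DirectSum.lof k ℕ V q a) y) =
      mul (bracket (DirectSum.lof k ℕ V p c) (DirectSum.lof k ℕ V q a)) y +
        (-1 : k) ^ ((p + 1) * q) •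
          mul (DirectSum.lof k ℕ V q a) (bracket (DirectSum.lof k ℕ V p c) y)

/-- A Batalin-Vilkovisky algebra: a Gerstenhaber algebra with a differential `B` of degree `-1`
which generates the bracket. -/
structure BatalinVilkoviskyAlgebra (k : Type*) [CommRing k] (V : ℕ → Type*)
    [∀ p, AddCommGroup (V p)] [∀ p, Module k (V p)] extends GerstenhaberAlgebra k V where
  /-- the differential -/
  B : (⨁ p, V p) →ₗ[k] (⨁ p, V p)
  B_zero : ∀ a : V 0, B (DirectSum.lof k ℕ V 0 a) = 0
  B_mem : ∀ (p : ℕ) (a : V (p + 1)),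
    B (DirectSum.lof k ℕ V (p + 1) a) ∈ LinearMap.range (DirectSum.lof k ℕ V p)
  B_B : ∀ x, B (B x) = 0
  bracket_eq : ∀ (p : ℕ) (a : V p) (y : ⨁ p, V p),
    bracket (DirectSum.lof k ℕ V p a) y =
      (-1 : k) ^ p • (B (mul (DirectSum.lof k ℕ V p a) y) - mul (B (DirectSum.lof k ℕ V p a)) y -
        (-1 : k) ^ p • mul (DirectSum.lof k ℕ V p a) (B y))

/-! ### Symmetric algebras -/

/-- The `k`-algebra `A` is symmetric: there is an isomorphism `A ≅ A* = Hom_k(A, k)` of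
`A`-bimodules, where `(b · φ · c)(x) = φ (c * x * b)`. -/
def AlgebraIsSymmetric (k A : Type*) [CommRing k] [Ring A] [Algebra k A] : Prop :=
  ∃ e : A ≃ₗ[k] Module.Dual k A, ∀ b a c x : A, e (b * a * c) x = e a (c * x * b)

/-! ### The Hochschild complex of an algebra with coefficients in itself -/

/-- Hochschild cochains `C^n(A, A) = Hom_k(A^{⊗ n}, A)`, as `k`-multilinear maps. -/
abbrev HochschildCochain (k A : Type*) [CommRing k] [Ring A] [Algebra k A] (n : ℕ) : Type _ :=
  MultilinearMap k (fun _ : Fin n => A) A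

/-- The usual additive group of multilinear maps, recorded to help instance search. -/
instance HochschildCochain.instAddCommGroup (k A : Type*) [CommRing k] [Ring A] [Algebra k A]
    (n : ℕ) : AddCommGroup (HochschildCochain k A n) := inferInstance

namespace HochschildCochain

section

variable {k A : Type*} [CommRing k] [Ring A] [Algebra k A]

/-- The cup product of cochains,
`(f ⌣ g)(a₁, …, a_{p+q}) = f(a₁, …, a_p) * g(a_{p+1}, …, a_{p+q})`. -/
noncomputable def cup {p q n : ℕ} (h : p + q = n) (f : HochschildCochain k A p)
    (g : HochschildCochain k A q) : HochschildCochain k A n :=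
  ((LinearMap.mul' k A).compMultilinearMap (f.domCoprod g)).domDomCongr
    (finSumFinEquiv.trans (finCongr h))

theorem cup_apply {p q n : ℕ} (h : p + q = n) (f : HochschildCochain k A p)
    (g : HochschildCochain k A q) (a : Fin n → A) :
    cup h f g a = f (fun i => a ⟨i, by omega⟩) * g (fun j => a ⟨p + j, by omega⟩) := by
  rfl

/-- The arguments `(a₁, …, a_{i-1}, g(a_i, …, a_{i+q-1}), a_{i+q}, …, a_{p+q-1})`, where the
position `i` is counted from `0` in the code. -/
def insertArgs {p q n : ℕ} (h : p + q = n + 1) (i : Fin p) (g : HochschildCochain k A q)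
    (a : Fin n → A) : Fin p → A := fun j =>
  if hj : j.val < i.val then a ⟨j, by omega⟩
  else if hj' : j.val = i.val then g (fun l => a ⟨i + l, by omega⟩)
  else a ⟨j + q - 1, by omega⟩

theorem exists_insertArgs_update {p q n : ℕ} (h : p + q = n + 1) (i : Fin p)
    (g : HochschildCochain k A q) (a : Fin n → A) (m : Fin n) :
    (∃ j : Fin p, ∀ x, insertArgs h i g (Function.update a m x) =
      Function.update (insertArgs h i g a) j x) ∨
    (∃ l : Fin q, ∀ x, insertArgs h i g (Function.update a m x) =
      Function.update (insertArgs h i g a) i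
        (g (Function.update (fun l => a ⟨i + l, by omega⟩) l x))) := by
  rcases lt_or_ge m.val i.val with hm | hm
  · left
    refine ⟨⟨m, by omega⟩, fun x => ?_⟩
    ext j
    simp only [insertArgs, Function.update_apply, Fin.ext_iff]
    split_ifs <;> first | rfl | omega | skip
    congr 1; ext l
    split_ifs <;> first | rfl | omega
  · rcases lt_or_ge m.val (i.val + q) with hq | hq
    · right
      refine ⟨⟨m - i, by omega⟩, fun x => ?_⟩
      ext j
      simp only [insertArgs, Function.update_apply, Fin.ext_iff]
      split_ifs <;> first | rfl | omega | skip
      congr 1; ext l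
      simp only [Function.update_apply, Fin.ext_iff]
      split_ifs <;> first | rfl | omega
    · left
      refine ⟨⟨m + 1 - q, by omega⟩, fun x => ?_⟩
      ext j
      simp only [insertArgs, Function.update_apply, Fin.ext_iff]
      split_ifs <;> first | rfl | omega | skip
      congr 1; ext l
      split_ifs <;> first | rfl | omega

/-- The insertion
`(f ∘_i g)(a₁, …, a_{p+q-1}) = f(a₁, …, a_{i-1}, g(a_i, …, a_{i+q-1}), a_{i+q}, …, a_{p+q-1})`,
where the position `i` is counted from `0` in the code. -/
def insert {p q n : ℕ} (h : p + q = n + 1) (i : Fin p) (f : HochschildCochain k A p)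
    (g : HochschildCochain k A q) : HochschildCochain k A n :=
  MultilinearMap.mk' (fun a => f (insertArgs h i g a))
    (by
      intro a m x y
      rcases exists_insertArgs_update h i g a m with ⟨j, hj⟩ | ⟨l, hl⟩
      · simp only [hj, MultilinearMap.map_update_add]
      · simp only [hl, MultilinearMap.map_update_add])
    (by
      intro a m c x
      rcases exists_insertArgs_update h i g a m with ⟨j, hj⟩ | ⟨l, hl⟩
      · simp only [hj, MultilinearMap.map_update_smul]
      · simp only [hl, MultilinearMap.map_update_smul])

theorem insert_apply {p q n : ℕ} (h : p + q = n + 1) (i : Fin p) (f : HochschildCochain k A p)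
    (g : HochschildCochain k A q) (a : Fin n → A) :
    insert h i f g a = f (insertArgs h i g a) := rfl

/-- The composition
`f ∘ g = (-1)^{(p-1)(q-1)} ∑_{i=1}^p (-1)^{(q-1)(i-1)} f ∘_i g`. -/
def comp {p q n : ℕ} (h : p + q = n + 1) (f : HochschildCochain k A p)
    (g : HochschildCochain k A q) : HochschildCochain k A n :=
  (-1 : k) ^ ((p + 1) * (q + 1)) •
    ∑ i : Fin p, (-1 : k) ^ ((q + 1) * i.val) • insert h i f g

/-- The Gerstenhaber bracket of cochains, `{f, g} = f ∘ g - (-1)^{(p-1)(q-1)} g ∘ f`. -/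
def bracket {p q n : ℕ} (h : p + q = n + 1) (f : HochschildCochain k A p)
    (g : HochschildCochain k A q) : HochschildCochain k A n :=
  comp h f g - (-1 : k) ^ ((p + 1) * (q + 1)) • comp ((Nat.add_comm q p).trans h) g f

variable (k A) in
/-- The identity of `A` as a `1`-cochain. -/
def id : HochschildCochain k A 1 := MultilinearMap.ofSubsingleton k A A 0 LinearMap.id

variable (k A) in
/-- The multiplication of `A` as a `2`-cochain. -/
def mul : HochschildCochain k A 2 := MultilinearMap.mkPiAlgebraFin k 2 A

variable (k A) in
/-- The unit of `A` as a `0`-cochain. -/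
def one : HochschildCochain k A 0 := MultilinearMap.constOfIsEmpty k (fun _ : Fin 0 => A) 1

/-- The Hochschild coboundary of a cochain; see `differentialFun_apply` for the formula. -/
noncomputable def differentialFun {n : ℕ} (f : HochschildCochain k A n) :
    HochschildCochain k A (n + 1) :=
  cup (Nat.add_comm 1 n) (id k A) f +
    ∑ i : Fin n, (-1 : k) ^ (i.val + 1) • insert (q := 2) (n := n + 1) rfl i f (mul k A) +
    (-1 : k) ^ (n + 1) • cup rfl f (id k A)

/-- `(a₁, …, a_{n+1}) ↦ a₁ * f(a₂, …, a_{n+1}) + ∑ i, (-1)^i f(a₁, …, a_i * a_{i+1}, …, a_{n+1})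
+ (-1)^{n+1} f(a₁, …, a_n) * a_{n+1}`. -/
theorem differentialFun_apply {n : ℕ} (f : HochschildCochain k A n) (a : Fin (n + 1) → A) :
    differentialFun f a =
      a 0 * f (fun j => a j.succ) +
        ∑ i : Fin n, (-1 : k) ^ (i.val + 1) • f (Fin.contractNth i.castSucc (· * ·) a) +
        (-1 : k) ^ (n + 1) • (f (fun j => a j.castSucc) * a (Fin.last n)) := by
  simp only [differentialFun, add_apply, sum_apply, smul_apply, cup_apply, insert_apply]
  congr 1
  · congr 1
    · congr 2
      ext j
      congr 1
      exact Fin.ext (Nat.add_comm 1 j)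
    · refine Finset.sum_congr rfl fun i _ => ?_
      congr 2
      ext j
      simp only [insertArgs, Fin.contractNth, Fin.val_castSucc]
      split_ifs with h1 h2
      · rfl
      · have hj : j = i := Fin.ext h2
        subst hj
        simp [mul, List.ofFn_succ]
        rfl
      · rfl

variable (k A) in
/-- The Hochschild differential `C^n(A, A) → C^{n+1}(A, A)`. -/
noncomputable def differential (n : ℕ) :
    HochschildCochain k A n →ₗ[k] HochschildCochain k A (n + 1) where
  toFun := differentialFun
  map_add' f g := by
    ext a
    simp only [add_apply, differentialFun_apply, mul_add, add_mul, smul_add,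
      Finset.sum_add_distrib]
    abel
  map_smul' c f := by
    ext a
    simp only [smul_apply, differentialFun_apply, mul_smul_comm, smul_mul_assoc,
      smul_add, Finset.smul_sum, RingHom.id_apply, smul_comm c]

variable (k A) in
/-- The Hochschild cocycles of degree `n`. -/
noncomputable abbrev cocycles (n : ℕ) : Submodule k (HochschildCochain k A n) :=
  LinearMap.ker (differential k A n)

variable (k A) in
/-- The Hochschild coboundaries of degree `n`. -/
noncomputable def coboundaries : (n : ℕ) → Submodule k (HochschildCochain k A n)
  | 0 => ⊥
  | n + 1 => LinearMap.range (differential k A n)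

end

end HochschildCochain

/-- The Hochschild cohomology `H^n(A, A)`: cocycles modulo coboundaries. -/
abbrev HochschildCohomology (k A : Type*) [CommRing k] [Ring A] [Algebra k A] (n : ℕ) : Type _ :=
  HochschildCochain.cocycles k A n ⧸
    (HochschildCochain.coboundaries k A n).submoduleOf (HochschildCochain.cocycles k A n)

/-- The class of a cocycle `f` of degree `n` in `⨁ n, H^n(A, A)`. -/
noncomputable def HochschildCohomology.cls {k A : Type*} [CommRing k] [Ring A] [Algebra k A]
    {n : ℕ} (f : HochschildCochain k A n) (hf : f ∈ HochschildCochain.cocycles k A n) :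
    ⨁ n, HochschildCohomology k A n :=
  DirectSum.lof k ℕ (HochschildCohomology k A) n (Submodule.Quotient.mk ⟨f, hf⟩)

/-! All cochains are read as functions on words in `A`, a cochain of degree `n` vanishing off words
of length `n`. Signs can then be computed from the lengths of subwords, and no equalities between
degrees have to be transported. A degree matters only through its parity, so `p + 1` stands for `p -
1` throughout. Each identity becomes a comparison of sums over the ways to cut a word into
consecutive pieces.

For the Gerstenhaber structure, the basic fact is the pre-Lie identity `wordComp_wordComp`: the
failure of insertion to be associative consists of the simultaneous insertions `F{f, g}` and `F{g,
f}` (`wordBrace`). It gives the graded Jacobi identity on cochains. With the multiplication `μ` as a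
2-cochain, the differential is the bracket with `μ`, and `μ{f, g}` is the cup product up to sign.
Applying the pre-Lie identity to `μ` shows that `F ∘ G` is a homotopy for graded commutativity of
the cup product (`wordDiff_wordComp`). One level higher, comparing `(F{f, g}) ∘ μ` with `(F ∘ μ){f,
g}` shows that the brace `F{f, g}` is a homotopy for the Leibniz rule (`wordDiff_wordBrace`).

For the operator `B`, symmetry of `A` provides a trace form `tr` for which an element is determined
by its pairings and every linear form is represented. Define `Δf` by letting `tr (a * Δf(w))` be the
signed sum of `tr (f(r))` over the rotations `r` of the cyclic word formed by `a` and `w`. This is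
the dual of the map `sN` of cyclic homology, which anticommutes with the Hochschild differential
without any normalization (`wordDiff_wordConnes`). Its square is not zero on cochains: by cyclic
invariance `ΔΔf` is minus the insertion of the unit into `Δf`. On a cocycle such an insertion is
exact, since the bracket is a derivation up to homotopy and `1 ⌣ 1 = 1`.

For the Batalin-Vilkovisky relation, the rotations in `Δ(f ⌣ g)` are sorted by whether `a` falls
among the arguments of `f` or of `g`. Each half is, up to sign and a coboundary, a combination of
one insertion and one product: `f ∘ g` with `Δf ⌣ g`, and `g ∘ f` with `Δg ⌣ f`. The homotopy
evaluates `f` on rotated words into which `g` has been inserted before `a`. Commuting `Δg` past `f`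
on cohomology gives the relation.

To pass to cohomology, the total cohomology is embedded into word functions modulo differentials of
multilinear word functions (`totalCohomologyWord_injective`). An axiom then amounts to an identity
of word functions together with an explicit homotopy. -/

set_option linter.unusedSimpArgs false
set_option linter.unusedSectionVars false

/-! ### Sums over the ways to cut a word in two -/

section SplitSum

variable {α M N : Type*} [AddCommGroup M] [AddCommGroup N]

/-- The sum of `φ u v` over all ways to write the word `w` as `u ++ v`. -/
def splitSum (w : List α) (φ : List α → List α → M) : M :=
  ∑ i ∈ Finset.range (w.length + 1), φ (w.take i) (w.drop i)

theorem splitSum_nil (φ : List α → List α → M) : splitSum [] φ = φ [] [] := by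
  simp [splitSum]

theorem splitSum_cons (φ : List α → List α → M) (a : α) (w : List α) :
    splitSum (a :: w) φ = φ [] (a :: w) + splitSum w (fun u v => φ (a :: u) v) := by
  simp only [splitSum, List.length_cons]
  rw [Finset.sum_range_succ']
  simp [add_comm]

theorem splitSum_congr {φ ψ : List α → List α → M} {w : List α}
    (h : ∀ u v, u ++ v = w → φ u v = ψ u v) : splitSum w φ = splitSum w ψ :=
  Finset.sum_congr rfl fun _ _ => h _ _ (List.take_append_drop _ _)

theorem splitSum_congr_all {φ ψ : List α → List α → M} {w : List α}
    (h : ∀ u v, φ u v = ψ u v) : splitSum w φ = splitSum w ψ :=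
  splitSum_congr fun u v _ => h u v

theorem splitSum_add (φ ψ : List α → List α → M) (w : List α) :
    splitSum w (fun u v => φ u v + ψ u v) = splitSum w φ + splitSum w ψ :=
  Finset.sum_add_distrib

theorem splitSum_neg (φ : List α → List α → M) (w : List α) :
    splitSum w (fun u v => -φ u v) = -splitSum w φ := by
  simp [splitSum]

theorem splitSum_sub (φ ψ : List α → List α → M) (w : List α) :
    splitSum w (fun u v => φ u v - ψ u v) = splitSum w φ - splitSum w ψ := by
  simp [splitSum]

theorem splitSum_zero (w : List α) : splitSum w (fun _ _ => (0 : M)) = 0 := by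
  simp [splitSum]

theorem smul_splitSum {S : Type*} [DistribSMul S M] (c : S) (φ : List α → List α → M)
    (w : List α) : c • splitSum w φ = splitSum w (fun u v => c • φ u v) :=
  Finset.smul_sum

theorem map_splitSum {F : Type*} [FunLike F M N] [AddMonoidHomClass F M N] (f : F)
    (φ : List α → List α → M) (w : List α) :
    f (splitSum w φ) = splitSum w (fun u v => f (φ u v)) :=
  map_sum f _ _

theorem splitSum_mul {R : Type*} [Ring R] (φ : List α → List α → R) (w : List α) (x : R) :
    splitSum w φ * x = splitSum w (fun u v => φ u v * x) :=
  Finset.sum_mul _ _ _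

theorem mul_splitSum {R : Type*} [Ring R] (φ : List α → List α → R) (w : List α) (x : R) :
    x * splitSum w φ = splitSum w (fun u v => x * φ u v) :=
  Finset.mul_sum _ _ _

theorem splitSum_comm (φ : List α → List α → List α → List α → M) (w x : List α) :
    splitSum w (fun u v => splitSum x (fun s t => φ u v s t)) =
      splitSum x (fun s t => splitSum w (fun u v => φ u v s t)) :=
  Finset.sum_comm

/-- Cutting a word in three, starting from the right or from the left. -/
theorem splitSum_assoc (φ : List α → List α → List α → List α → M) (w : List α) :
    splitSum w (fun y z => splitSum y (fun u v => φ y u v z)) =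
      splitSum w (fun u x => splitSum x (fun v z => φ (u ++ v) u v z)) := by
  induction w generalizing φ with
  | nil => simp [splitSum_nil]
  | cons a w ih =>
    simp only [splitSum_cons, splitSum_nil, splitSum_add]
    rw [ih fun y u v z => φ (a :: y) (a :: u) v z]
    simp only [List.cons_append, List.nil_append]
    abel

/-- This and its two longer variants serve as rewriting rules: they move a cut of the first block to
the front. Nested cuts thereby reach a normal form in which the word is cut successively from left
to right, and sums can be compared summand by summand. -/
theorem splitSum_assoc_right (φ : List α → List α → List α → List α → List α → M)
    (w : List α) :
    splitSum w (fun u x => splitSum x (fun v z => splitSum u (fun s t => φ u s t v z))) =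
      splitSum w (fun s y => splitSum y (fun t x => splitSum x
        (fun v z => φ (s ++ t) s t v z))) := by
  rw [← splitSum_assoc fun y s t x => splitSum x (fun v z => φ y s t v z)]
  exact splitSum_congr fun u x _ => splitSum_comm _ _ _

theorem splitSum_assoc_right₂
    (φ : List α → List α → List α → List α → List α → List α → M) (w : List α) :
    splitSum w (fun u x => splitSum x (fun v y => splitSum y (fun a b =>
      splitSum u (fun s t => φ u s t v a b)))) =
      splitSum w (fun s x => splitSum x (fun t x => splitSum x (fun v y => splitSum y (fun a b =>
        φ (s ++ t) s t v a b)))) := by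
  rw [← splitSum_assoc_right fun u s t v y => splitSum y (fun a b => φ u s t v a b)]
  exact splitSum_congr fun u x _ => splitSum_congr fun v y _ => splitSum_comm _ _ _

theorem splitSum_assoc_right₃
    (φ : List α → List α → List α → List α → List α → List α → List α → M) (w : List α) :
    splitSum w (fun u x => splitSum x (fun v y => splitSum y (fun a b => splitSum b (fun c d =>
      splitSum u (fun s t => φ u s t v a c d))))) =
      splitSum w (fun s x => splitSum x (fun t x => splitSum x (fun v y => splitSum y (fun a b =>
        splitSum b (fun c d => φ (s ++ t) s t v a c d))))) := by
  rw [← splitSum_assoc_right₂ fun u s t v a b => splitSum b (fun c d => φ u s t v a c d)]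
  exact splitSum_congr fun u x _ => splitSum_congr fun v y _ => splitSum_congr fun a b _ =>
    splitSum_comm _ _ _

/-- A cut of a word with a marked letter lies before or after that letter. -/
theorem splitSum_append_cons (φ : List α → List α → M) (u : List α) (c : α) (z : List α) :
    splitSum (u ++ c :: z) φ =
      splitSum u (fun s t => φ s (t ++ c :: z)) + splitSum z (fun s t => φ (u ++ c :: s) t) := by
  induction u generalizing φ with
  | nil => simp [splitSum_cons, splitSum_nil]
  | cons a u ih => simp [splitSum_cons, ih, add_assoc]

theorem splitSum_eq_left {φ : List α → List α → M} (h : ∀ a u v, φ (a :: u) v = 0)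
    (w : List α) : splitSum w φ = φ [] w := by
  cases w <;> simp [splitSum_nil, splitSum_cons, h, splitSum_zero]

theorem splitSum_eq_right {φ : List α → List α → M} (h : ∀ u a v, φ u (a :: v) = 0)
    (w : List α) : splitSum w φ = φ w [] := by
  induction w generalizing φ with
  | nil => simp [splitSum_nil]
  | cons a w ih => simp [splitSum_cons, h, ih]

end SplitSum

section Sign

theorem neg_one_pow_smul_congr {M : Type*} [AddCommGroup M] {m n : ℕ} (h : Even m ↔ Even n)
    (x : M) : (-1 : ℤ) ^ m • x = (-1 : ℤ) ^ n • x := by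
  rw [neg_one_pow_congr h]

end Sign

/-! ### Multilinear functions of words -/

section Words

variable {k A M N : Type*} [CommRing k] [Ring A] [Algebra k A] [AddCommGroup M] [Module k M]
  [AddCommGroup N] [Module k N]

variable (k) in
/-- A function of words is multilinear if it is linear in each letter. -/
def WordMultilinear (F : List A → M) : Prop :=
  ∀ u v : List A, IsLinearMap k fun a => F (u ++ a :: v)

namespace WordMultilinear

variable {F : List A → M}

/-- The dependence on a letter of a multilinear function of words as an additive map. -/
def toAddMonoidHom (hF : WordMultilinear k F) (u v : List A) : A →+ M :=
  ((hF u v).mk').toAddMonoidHom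

theorem map_add (hF : WordMultilinear k F) (u v : List A) (a b : A) :
    F (u ++ (a + b) :: v) = F (u ++ a :: v) + F (u ++ b :: v) :=
  _root_.map_add (hF.toAddMonoidHom u v) a b

theorem map_sub (hF : WordMultilinear k F) (u v : List A) (a b : A) :
    F (u ++ (a - b) :: v) = F (u ++ a :: v) - F (u ++ b :: v) :=
  _root_.map_sub (hF.toAddMonoidHom u v) a b

theorem map_zero (hF : WordMultilinear k F) (u v : List A) : F (u ++ 0 :: v) = 0 :=
  _root_.map_zero (hF.toAddMonoidHom u v)

theorem map_zsmul (hF : WordMultilinear k F) (u v : List A) (n : ℤ) (a : A) :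
    F (u ++ (n • a) :: v) = n • F (u ++ a :: v) :=
  _root_.map_zsmul (hF.toAddMonoidHom u v) n a

theorem map_splitSum {α : Type*} (hF : WordMultilinear k F) (u v : List A)
    (φ : List α → List α → A) (w : List α) :
    F (u ++ splitSum w φ :: v) = splitSum w (fun s t => F (u ++ φ s t :: v)) :=
  _root_.map_splitSum (hF.toAddMonoidHom u v) φ w

theorem map_zero₂ (hF : WordMultilinear k F) (u v x : List A) (c : A) :
    F (u ++ c :: (v ++ 0 :: x)) = 0 := by
  simpa using hF.map_zero (u ++ c :: v) x

theorem map_zero₃ (hF : WordMultilinear k F) (u v x y : List A) (c d : A) :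
    F (u ++ c :: (v ++ d :: (x ++ 0 :: y))) = 0 := by
  simpa using hF.map_zero (u ++ c :: (v ++ d :: x)) y

theorem map_add₂ (hF : WordMultilinear k F) (u v x : List A) (c a b : A) :
    F (u ++ c :: (v ++ (a + b) :: x)) =
      F (u ++ c :: (v ++ a :: x)) + F (u ++ c :: (v ++ b :: x)) := by
  simpa using hF.map_add (u ++ c :: v) x a b

theorem map_zsmul₂ (hF : WordMultilinear k F) (u v x : List A) (c : A) (n : ℤ) (a : A) :
    F (u ++ c :: (v ++ (n • a) :: x)) = n • F (u ++ c :: (v ++ a :: x)) := by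
  simpa using hF.map_zsmul (u ++ c :: v) x n a

theorem map_splitSum₂ {α : Type*} (hF : WordMultilinear k F) (u v x : List A) (c : A)
    (φ : List α → List α → A) (w : List α) :
    F (u ++ c :: (v ++ splitSum w φ :: x)) =
      splitSum w (fun s t => F (u ++ c :: (v ++ φ s t :: x))) := by
  simpa using hF.map_splitSum (u ++ c :: v) x φ w

end WordMultilinear

/-- The cup product of functions of words. -/
def wordCup (F G : List A → A) (w : List A) : A :=
  splitSum w (fun u v => F u * G v)

/-- The sum of all insertions of `g` into `F`, with the signs of Gerstenhaber. -/
def wordComp (F : List A → M) (g : List A → A) (w : List A) : M :=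
  splitSum w (fun u x => splitSum x (fun v z =>
    (-1 : ℤ) ^ ((v.length + 1) * u.length) • F (u ++ g v :: z)))

/-- The sum of all simultaneous insertions of `f` and, further to the right, `g` into `F`. -/
def wordBrace (F : List A → M) (f g : List A → A) (w : List A) : M :=
  splitSum w (fun u x => splitSum x (fun v y => splitSum y (fun s z => splitSum z (fun t r =>
    (-1 : ℤ) ^ ((v.length + 1) * u.length + (t.length + 1) * (u.length + v.length + s.length)) •
      F (u ++ f v :: (s ++ g t :: r))))))

/-- The word function of the identity of `A`. -/
def wordId : List A → A
  | [a] => a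
  | _ => 0

/-- The word function of the multiplication of `A`. -/
def wordMul : List A → A
  | [a, b] => a * b
  | _ => 0

/-- The word function of the unit of `A`. -/
def wordOne : List A → A
  | [] => 1
  | _ => 0

/-- The Hochschild differential on functions of words. -/
def wordDiff (F : List A → A) (w : List A) : A :=
  wordCup wordId F w - wordComp F wordMul w +
    splitSum w (fun u v => (-1 : ℤ) ^ (u.length + 1) • (F u * wordId v))

/-- A function of words has parity `p` if it vanishes on all words of length of other parity. -/
def HasWordParity (p : ℕ) (F : List A → M) : Prop :=
  ∀ w, F w = 0 ∨ (Even w.length ↔ Even p)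

/-- The graded pre-Lie identity. In an iterated insertion the block of `g` lies inside the arguments
of `f`, to their right, or to their left; the last case costs the sign of exchanging `f` and `g` in
shifted degree. -/
theorem wordComp_wordComp {F : List A → M} (hF : WordMultilinear k F) {f g : List A → A} {p q : ℕ}
    (hf : HasWordParity p f) (hg : HasWordParity q g) :
    wordComp (wordComp F f) g = wordComp F (wordComp f g) + wordBrace F f g +
      (-1 : ℤ) ^ ((p + 1) * (q + 1)) • wordBrace F g f := by
  ext w
  simp only [Pi.add_apply, Pi.smul_apply]
  simp only [wordComp, wordBrace, splitSum_append_cons, splitSum_add, smul_add, hF.map_splitSum,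
    hF.map_zsmul, smul_splitSum, splitSum_assoc, splitSum_assoc_right, smul_smul, ← pow_add,
    List.append_assoc, List.cons_append]
  -- The cuts list the positions of `f` as left of `g`, around `g`, right of `g`; the first two are
  -- exchanged.
  rw [add_assoc, add_left_comm, ← add_assoc]
  refine congrArg₂ (· + ·) (congrArg₂ (· + ·) ?_ ?_) ?_
  · refine splitSum_congr_all fun u _ => splitSum_congr_all fun v _ => splitSum_congr_all fun s _ =>
      splitSum_congr_all fun t r => neg_one_pow_smul_congr ?_ _
    simp only [List.length_append, List.length_cons, parity_simps]
    grind
  · refine splitSum_congr_all fun u _ => splitSum_congr_all fun v _ => splitSum_congr_all fun s _ =>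
      splitSum_congr_all fun t r => neg_one_pow_smul_congr ?_ _
    simp only [List.length_append, List.length_cons, parity_simps]
    grind
  · refine splitSum_congr_all fun u _ => splitSum_congr_all fun v _ => splitSum_congr_all fun s _ =>
      splitSum_congr_all fun t r => ?_
    rcases hg v with h | h
    · simp [h, hF.map_zero]
    rcases hf t with h' | h'
    · simp [h', hF.map_zero₂]
    refine neg_one_pow_smul_congr ?_ _
    simp only [List.length_append, List.length_cons, parity_simps]
    grind

theorem wordCup_assoc (F G H : List A → A) :
    wordCup (wordCup F G) H = wordCup F (wordCup G H) := by
  ext w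
  simp only [wordCup, splitSum_mul, mul_splitSum, splitSum_assoc, mul_assoc]

theorem wordCup_wordOne (F : List A → A) : wordCup F wordOne = F := by
  ext w
  rw [wordCup, splitSum_eq_right (by simp [wordOne])]
  simp [wordOne]

theorem wordOne_wordCup (F : List A → A) : wordCup wordOne F = F := by
  ext w
  rw [wordCup, splitSum_eq_left (by simp [wordOne])]
  simp [wordOne]

end Words

/-! ### Parity, and the behaviour of cups and braces under insertion -/

section Words

variable {k A M N : Type*} [CommRing k] [Ring A] [Algebra k A] [AddCommGroup M] [Module k M]
  [AddCommGroup N] [Module k N]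

theorem splitSum_eq_zero {α : Type*} {φ : List α → List α → M} {w : List α}
    (h : ∀ u v, u ++ v = w → φ u v = 0) : splitSum w φ = 0 :=
  (splitSum_congr h).trans (splitSum_zero w)

theorem HasWordParity.cup {F G : List A → A} {p q : ℕ} (hF : HasWordParity p F)
    (hG : HasWordParity q G) : HasWordParity (p + q) (wordCup F G) := by
  intro w
  by_cases h : Even w.length ↔ Even (p + q)
  · exact .inr h
  refine .inl (splitSum_eq_zero fun u v huv => ?_)
  rcases hF u with h1 | h1
  · simp [h1]
  rcases hG v with h2 | h2
  · simp [h2]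
  rw [← huv, List.length_append, Nat.even_add, Nat.even_add, h1, h2] at h
  exact absurd Iff.rfl h

theorem HasWordParity.comp {F g : List A → A} {p q : ℕ} (hF : HasWordParity p F)
    (hF' : WordMultilinear k F) (hg : HasWordParity q g) :
    HasWordParity (p + q + 1) (wordComp F g) := by
  intro w
  by_cases h : Even w.length ↔ Even (p + q + 1)
  · exact .inr h
  refine .inl (splitSum_eq_zero fun u x hux => splitSum_eq_zero fun v z hvz => ?_)
  rcases hg v with h1 | h1
  · simp [h1, hF'.map_zero]
  rcases hF (u ++ g v :: z) with h2 | h2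
  · simp [h2]
  subst hvz hux
  simp only [List.length_append, List.length_cons, parity_simps] at *
  grind

theorem hasWordParity_wordId : HasWordParity 1 (wordId : List A → A) := by
  rintro (_ | ⟨a, _ | ⟨b, w⟩⟩) <;> simp [wordId]

theorem hasWordParity_wordMul : HasWordParity 0 (wordMul : List A → A) := by
  rintro (_ | ⟨a, _ | ⟨b, _ | ⟨c, w⟩⟩⟩) <;> simp [wordMul]

theorem wordMultilinear_wordId : WordMultilinear k (wordId : List A → A) := by
  rintro (_ | ⟨a, _ | ⟨b, w⟩⟩) (_ | ⟨c, x⟩) <;>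
    constructor <;> intros <;> simp [wordId]

theorem wordMultilinear_wordMul : WordMultilinear k (wordMul : List A → A) := by
  rintro (_ | ⟨a, _ | ⟨b, _ | ⟨b, w⟩⟩⟩) (_ | ⟨c, _ | ⟨d, x⟩⟩) <;>
    constructor <;> intros <;> simp [wordMul, mul_add, add_mul]

/-- The inserted block falls among the arguments of `G` or of `F`. Insertion on the right is thus a
strict derivation of the cup product; only insertion into a cup product needs no homotopy. -/
theorem wordCup_wordComp {F G : List A → A} {g : List A → A} {p q : ℕ}
    (hF : HasWordParity p F) (hG : WordMultilinear k G) (hg : HasWordParity q g) :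
    wordComp (wordCup F G) g = (-1 : ℤ) ^ ((q + 1) * p) • wordCup F (wordComp G g) +
      wordCup (wordComp F g) G := by
  ext w
  simp only [Pi.add_apply, Pi.smul_apply]
  simp only [wordComp, wordCup, splitSum_append_cons, splitSum_add, splitSum_mul,
    mul_splitSum, smul_mul_assoc, mul_smul_comm, smul_splitSum, splitSum_assoc,
    splitSum_assoc_right, splitSum_assoc_right₂, splitSum_assoc_right₃,
    smul_add, smul_smul, ← pow_add]
  refine congrArg₂ (· + ·) (splitSum_congr_all fun u _ => splitSum_congr_all fun v _ =>
    splitSum_congr_all fun s t => ?_) (by rfl)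
  rcases hF u with h | h
  · simp [h]
  rcases hg s with h' | h'
  · simp [h', hG.map_zero]
  refine neg_one_pow_smul_congr ?_ _
  simp only [List.length_append, parity_simps]
  grind

/-- Since `f` stays to the left of `g`, the two blocks either both go to `G`, or are shared between
`F` and `G` in this order, or both go to `F`. -/
theorem wordCup_wordBrace {F G : List A → A} {f g : List A → A} {r p q : ℕ}
    (hF : HasWordParity r F) (hF' : WordMultilinear k F) (hG : WordMultilinear k G)
    (hf : HasWordParity p f) (hg : HasWordParity q g) :
    wordBrace (wordCup F G) f g = (-1 : ℤ) ^ ((p + q) * r) • wordCup F (wordBrace G f g) +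
      ((-1 : ℤ) ^ ((q + 1) * (r + p + 1)) • wordCup (wordComp F f) (wordComp G g) +
      wordCup (wordBrace F f g) G) := by
  ext w
  simp only [Pi.add_apply, Pi.smul_apply]
  simp only [wordComp, wordBrace, wordCup, splitSum_append_cons, splitSum_add, splitSum_mul,
    mul_splitSum, smul_mul_assoc, mul_smul_comm, smul_splitSum, splitSum_assoc, smul_add,
    splitSum_assoc_right, splitSum_assoc_right₂, splitSum_assoc_right₃,
    smul_smul, ← pow_add]
  refine congrArg₂ (· + ·) ?_ (congrArg₂ (· + ·) ?_ rfl)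
  · refine splitSum_congr_all fun u _ => splitSum_congr_all fun v _ => splitSum_congr_all fun s _ =>
      splitSum_congr_all fun t _ => splitSum_congr_all fun a b => ?_
    rcases hF u with h | h
    · simp [h]
    rcases hf s with h1 | h1
    · simp [h1, hG.map_zero]
    rcases hg a with h2 | h2
    · simp [h2, hG.map_zero₂]
    refine neg_one_pow_smul_congr ?_ _
    simp only [List.length_append, List.length_cons, parity_simps] at *
    grind
  · refine splitSum_congr_all fun u _ => splitSum_congr_all fun v _ => splitSum_congr_all fun s _ =>
      splitSum_congr_all fun t _ => splitSum_congr_all fun a b => ?_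
    rcases hF (u ++ f v :: s) with h | h
    · simp [h]
    rcases hf v with h1 | h1
    · simp [h1, hF'.map_zero]
    rcases hg a with h2 | h2
    · simp [h2, hG.map_zero]
    refine neg_one_pow_smul_congr ?_ _
    simp only [List.length_append, List.length_cons, parity_simps] at *
    grind

/-- The sum of all simultaneous insertions of `f`, `g`, `h`, from left to right, into `F`. -/
def wordBrace₃ (F : List A → M) (f g h : List A → A) (w : List A) : M :=
  splitSum w (fun u x => splitSum x (fun v y => splitSum y (fun s z => splitSum z (fun t r =>
    splitSum r (fun a b => splitSum b (fun c d =>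
    (-1 : ℤ) ^ ((v.length + 1) * u.length + (t.length + 1) * (u.length + v.length + s.length) +
      (c.length + 1) * (u.length + v.length + s.length + t.length + a.length)) •
      F (u ++ f v :: (s ++ g t :: (a ++ h c :: d)))))))))

/-- The five summands are the positions of `h`: right of `g`, inside `g`, between, inside `f`, left
of `f`. -/
theorem wordBrace_wordComp {F : List A → M} (hF : WordMultilinear k F) {f g h : List A → A}
    {p q r : ℕ} (hf : HasWordParity p f) (hf' : WordMultilinear k f) (hg : HasWordParity q g)
    (hh : HasWordParity r h) :
    wordComp (wordBrace F f g) h =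
      wordBrace₃ F f g h + wordBrace F f (wordComp g h) +
        (-1 : ℤ) ^ ((q + 1) * (r + 1)) • wordBrace₃ F f h g +
        (-1 : ℤ) ^ ((q + 1) * (r + 1)) • wordBrace F (wordComp f h) g +
        (-1 : ℤ) ^ ((p + q) * (r + 1)) • wordBrace₃ F h f g := by
  ext w
  simp only [Pi.add_apply, Pi.smul_apply]
  simp only [wordComp, wordBrace, wordBrace₃, splitSum_append_cons, splitSum_add, smul_add,
    hF.map_splitSum, hF.map_splitSum₂, hF.map_zsmul₂,
    hF.map_zsmul, smul_splitSum, splitSum_assoc, splitSum_assoc_right, splitSum_assoc_right₂,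
    splitSum_assoc_right₃, smul_smul, ← pow_add,
    List.append_assoc, List.cons_append]
  refine congrArg₂ (· + ·) (congrArg₂ (· + ·) (congrArg₂ (· + ·) (congrArg₂ (· + ·) ?_ ?_)
    ?_) ?_) ?_
  · refine splitSum_congr_all fun u _ => splitSum_congr_all fun v _ => splitSum_congr_all fun s _ =>
      splitSum_congr_all fun t _ => splitSum_congr_all fun a _ => splitSum_congr_all fun b c => ?_
    refine neg_one_pow_smul_congr ?_ _
    simp only [List.length_append, List.length_cons, parity_simps] at *
    grind
  · refine splitSum_congr_all fun u _ => splitSum_congr_all fun v _ => splitSum_congr_all fun s _ =>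
      splitSum_congr_all fun t _ => splitSum_congr_all fun a _ => splitSum_congr_all fun b c => ?_
    refine neg_one_pow_smul_congr ?_ _
    simp only [List.length_append, List.length_cons, parity_simps] at *
    grind
  · refine splitSum_congr_all fun u _ => splitSum_congr_all fun v _ => splitSum_congr_all fun s _ =>
      splitSum_congr_all fun t _ => splitSum_congr_all fun a _ => splitSum_congr_all fun b c => ?_
    rcases hh t with h0 | h0
    · simp [h0, hF.map_zero₂]
    rcases hg b with h1 | h1
    · simp [h1, hF.map_zero₃]
    refine neg_one_pow_smul_congr ?_ _
    simp only [List.length_append, List.length_cons, parity_simps] at *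
    grind
  · refine splitSum_congr_all fun u _ => splitSum_congr_all fun v _ => splitSum_congr_all fun s _ =>
      splitSum_congr_all fun t _ => splitSum_congr_all fun a _ => splitSum_congr_all fun b c => ?_
    rcases hh s with h0 | h0
    · simp [h0, hf'.map_zero, hF.map_zero]
    rcases hg b with h1 | h1
    · simp [h1, hF.map_zero₂]
    refine neg_one_pow_smul_congr ?_ _
    simp only [List.length_append, List.length_cons, parity_simps] at *
    grind
  · refine splitSum_congr_all fun u _ => splitSum_congr_all fun v _ => splitSum_congr_all fun s _ =>
      splitSum_congr_all fun t _ => splitSum_congr_all fun a _ => splitSum_congr_all fun b c => ?_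
    rcases hh v with h0 | h0
    · simp [h0, hF.map_zero]
    rcases hf t with h1 | h1
    · simp [h1, hF.map_zero₂]
    rcases hg b with h2 | h2
    · simp [h2, hF.map_zero₃]
    refine neg_one_pow_smul_congr ?_ _
    simp only [List.length_append, List.length_cons, parity_simps] at *
    grind

/-- Here `h` is inserted first and may absorb `f`, `g`, both or neither. The terms with three
separate insertions are those of `wordBrace_wordComp` up to sign, so they cancel when both
identities are used with `h` the multiplication. -/
theorem wordBrace_of_wordComp {F : List A → M} (hF : WordMultilinear k F) {f g h : List A → A}
    {p q r : ℕ} (hf : HasWordParity p f) (hg : HasWordParity q g)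
    (hh : HasWordParity r h) (hh' : WordMultilinear k h) :
    wordBrace (wordComp F h) f g =
      wordBrace₃ F h f g + (wordBrace F (wordComp h f) g + wordComp F (wordBrace h f g)) +
        ((-1 : ℤ) ^ ((p + 1) * (r + 1)) • wordBrace₃ F f h g +
          (-1 : ℤ) ^ ((p + 1) * (r + 1)) • wordBrace F f (wordComp h g) +
          (-1 : ℤ) ^ ((p + q) * (r + 1)) • wordBrace₃ F f g h) := by
  ext w
  simp only [Pi.add_apply, Pi.smul_apply]
  simp only [wordComp, wordBrace, wordBrace₃, splitSum_append_cons, splitSum_add, smul_add,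
    hF.map_splitSum, hF.map_splitSum₂, hF.map_zsmul₂,
    hF.map_zsmul, smul_splitSum, splitSum_assoc, splitSum_assoc_right, splitSum_assoc_right₂,
    splitSum_assoc_right₃, smul_smul, ← pow_add,
    List.append_assoc, List.cons_append]
  refine congrArg₂ (· + ·) (congrArg₂ (· + ·) ?_ (congrArg₂ (· + ·) ?_ ?_))
    (congrArg₂ (· + ·) (congrArg₂ (· + ·) ?_ ?_) ?_)
  · refine splitSum_congr_all fun u _ => splitSum_congr_all fun v _ => splitSum_congr_all fun s _ =>
      splitSum_congr_all fun t _ => splitSum_congr_all fun a _ => splitSum_congr_all fun b c => ?_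
    refine neg_one_pow_smul_congr ?_ _
    simp only [List.length_append, List.length_cons, parity_simps] at *
    grind
  · refine splitSum_congr_all fun u _ => splitSum_congr_all fun v _ => splitSum_congr_all fun s _ =>
      splitSum_congr_all fun t _ => splitSum_congr_all fun a _ => splitSum_congr_all fun b c => ?_
    refine neg_one_pow_smul_congr ?_ _
    simp only [List.length_append, List.length_cons, parity_simps] at *
    grind
  · refine splitSum_congr_all fun u _ => splitSum_congr_all fun v _ => splitSum_congr_all fun s _ =>
      splitSum_congr_all fun t _ => splitSum_congr_all fun a _ => splitSum_congr_all fun b c => ?_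
    refine neg_one_pow_smul_congr ?_ _
    simp only [List.length_append, List.length_cons, parity_simps] at *
    grind
  · refine splitSum_congr_all fun u _ => splitSum_congr_all fun v _ => splitSum_congr_all fun s _ =>
      splitSum_congr_all fun t _ => splitSum_congr_all fun a _ => splitSum_congr_all fun b c => ?_
    rcases hf v with h0 | h0
    · simp [h0, hF.map_zero]
    rcases hh t with h1 | h1
    · simp [h1, hF.map_zero₂]
    refine neg_one_pow_smul_congr ?_ _
    simp only [List.length_append, List.length_cons, parity_simps] at *
    grind
  · refine splitSum_congr_all fun u _ => splitSum_congr_all fun v _ => splitSum_congr_all fun s _ =>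
      splitSum_congr_all fun t _ => splitSum_congr_all fun a _ => splitSum_congr_all fun b c => ?_
    rcases hh (t ++ g a :: b) with h0 | h0
    · simp [h0, hF.map_zero₂]
    rcases hg a with h1 | h1
    · simp [h1, hh'.map_zero, hF.map_zero₂]
    rcases hf v with h2 | h2
    · simp [h2, hF.map_zero]
    refine neg_one_pow_smul_congr ?_ _
    simp only [List.length_append, List.length_cons, parity_simps] at *
    grind
  · refine splitSum_congr_all fun u _ => splitSum_congr_all fun v _ => splitSum_congr_all fun s _ =>
      splitSum_congr_all fun t _ => splitSum_congr_all fun a _ => splitSum_congr_all fun b c => ?_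
    rcases hf v with h0 | h0
    · simp [h0, hF.map_zero]
    rcases hg t with h1 | h1
    · simp [h1, hF.map_zero₂]
    rcases hh b with h2 | h2
    · simp [h2, hF.map_zero₃]
    refine neg_one_pow_smul_congr ?_ _
    simp only [List.length_append, List.length_cons, parity_simps] at *
    grind

end Words

/-! ### The multiplication as a cochain: differential, homotopies and Jacobi identity -/

section Words

variable {k A M : Type*} [CommRing k] [Ring A] [Algebra k A] [AddCommGroup M] [Module k M]

theorem wordComp_wordId (g : List A → A) : wordComp wordId g = g := by
  ext w
  rw [wordComp, splitSum_eq_left, splitSum_eq_right]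
  · simp [wordId]
  · simp [wordId]
  · intro a u v
    refine splitSum_eq_zero fun s t _ => ?_
    cases u <;> simp [wordId]

theorem wordBrace_wordId (f g : List A → A) : wordBrace wordId f g = 0 := by
  ext w
  refine splitSum_eq_zero fun u _ _ => splitSum_eq_zero fun v _ _ => splitSum_eq_zero fun s _ _ =>
    splitSum_eq_zero fun t r _ => ?_
  rcases u with _ | ⟨a, u⟩
  · cases s <;> simp [wordId]
  · cases u <;> simp [wordId]

theorem wordMul_append_cons (u z : List A) (c : A) :
    wordMul (u ++ c :: z) = (if u = [] then 1 else 0) * c * wordId z +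
      (if z = [] then 1 else 0) * wordId u * c := by
  rcases u with _ | ⟨a, _ | ⟨b, u⟩⟩ <;> rcases z with _ | ⟨d, _ | ⟨e, z⟩⟩ <;>
    simp [wordMul, wordId]

theorem wordComp_wordMul {f : List A → A} {p : ℕ} (hf : HasWordParity p f) :
    wordComp wordMul f = wordCup f wordId + (-1 : ℤ) ^ (p + 1) • wordCup wordId f := by
  ext w
  simp only [wordComp, wordMul_append_cons, smul_add, splitSum_add, Pi.add_apply, Pi.smul_apply,
    wordCup, smul_splitSum]
  congr 1
  · rw [splitSum_eq_left]
    · simp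
    · intros
      exact splitSum_eq_zero fun _ _ _ => by simp
  · refine splitSum_congr_all fun u x => ?_
    rw [splitSum_eq_right]
    · rcases hf x with h | h
      · simp [h]
      rcases u with _ | ⟨a, _ | ⟨b, u⟩⟩ <;>
        simp only [wordId, if_true, one_mul, zero_mul, smul_zero]
      refine neg_one_pow_smul_congr ?_ _
      simp [parity_simps, h]
    · simp

/-- Two simultaneous insertions fill both arguments of the multiplication, so all other letters must
be absent. -/
theorem wordBrace_wordMul {f g : List A → A} {p q : ℕ} (hf : HasWordParity p f)
    (hg : HasWordParity q g) :
    wordBrace wordMul f g = (-1 : ℤ) ^ ((q + 1) * p) • wordCup f g := by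
  ext w
  rw [wordBrace, splitSum_eq_left]
  · simp only [Pi.smul_apply, wordCup, smul_splitSum]
    refine splitSum_congr_all fun v x => ?_
    rw [splitSum_eq_left, splitSum_eq_right]
    · rcases hf v with h | h
      · simp [h, wordMul]
      rcases hg x with h' | h'
      · simp [h', wordMul]
      simp only [wordMul, List.nil_append]
      refine neg_one_pow_smul_congr ?_ _
      simp only [List.length_nil, parity_simps]
      grind
    · intros; simp [wordMul]
    · rintro a (_ | ⟨b, u⟩) v <;> refine splitSum_eq_zero fun _ _ _ => ?_ <;> simp [wordMul]
  · rintro a (_ | ⟨b, u⟩) v <;> refine splitSum_eq_zero fun _ _ _ => splitSum_eq_zero fun s _ _ =>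
      splitSum_eq_zero fun _ _ _ => ?_ <;> cases s <;> simp [wordMul]

theorem wordDiff_eq {F : List A → A} {p : ℕ} (hF : HasWordParity p F) :
    wordDiff F = wordCup wordId F - wordComp F wordMul +
      (-1 : ℤ) ^ (p + 1) • wordCup F wordId := by
  ext w
  simp only [wordDiff, Pi.add_apply, Pi.sub_apply, Pi.smul_apply]
  congr 1
  simp only [wordCup, smul_splitSum]
  refine splitSum_congr_all fun u v => ?_
  rcases hF u with h | h
  · simp [h]
  exact neg_one_pow_smul_congr (by simp only [parity_simps, h]) _

/-- The right-hand side is the bracket of the multiplication with `F`. This lets the pre-Lie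
identity compute differentials. -/
theorem wordDiff_eq_wordComp {F : List A → A} {p : ℕ} (hF : HasWordParity p F) :
    wordDiff F = (-1 : ℤ) ^ (p + 1) • wordComp wordMul F - wordComp F wordMul := by
  rw [wordDiff_eq hF, wordComp_wordMul hF, smul_add, smul_smul, ← pow_add,
    Even.neg_one_pow ⟨p + 1, rfl⟩, one_smul]
  abel

theorem wordCup_add (F G H : List A → A) : wordCup F (G + H) = wordCup F G + wordCup F H := by
  ext w; simp [-zsmul_eq_mul, wordCup, mul_add, splitSum_add]

theorem add_wordCup (F G H : List A → A) : wordCup (F + G) H = wordCup F H + wordCup G H := by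
  ext w; simp [-zsmul_eq_mul, wordCup, add_mul, splitSum_add]

theorem wordCup_smul (c : ℤ) (F G : List A → A) : wordCup F (c • G) = c • wordCup F G := by
  ext w; simp [-zsmul_eq_mul, wordCup, smul_splitSum]

theorem smul_wordCup (c : ℤ) (F G : List A → A) : wordCup (c • F) G = c • wordCup F G := by
  ext w; simp [-zsmul_eq_mul, wordCup, smul_splitSum]

theorem wordCup_zero (F : List A → A) : wordCup F 0 = 0 := by
  ext w; simp [wordCup, splitSum_zero]

theorem zero_wordCup (F : List A → A) : wordCup 0 F = 0 := by
  ext w; simp [wordCup, splitSum_zero]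

theorem wordComp_add {F : List A → M} (hF : WordMultilinear k F) (f g : List A → A) :
    wordComp F (f + g) = wordComp F f + wordComp F g := by
  ext w; simp [-zsmul_eq_mul, wordComp, hF.map_add, splitSum_add]

theorem wordComp_smul {F : List A → M} (hF : WordMultilinear k F) (c : ℤ) (f : List A → A) :
    wordComp F (c • f) = c • wordComp F f := by
  ext w; simp [-zsmul_eq_mul, wordComp, hF.map_zsmul, smul_splitSum, smul_smul, mul_comm]

theorem add_wordComp (F G : List A → M) (f : List A → A) :
    wordComp (F + G) f = wordComp F f + wordComp G f := by
  ext w; simp [-zsmul_eq_mul, wordComp, splitSum_add]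

theorem smul_wordComp (c : ℤ) (F : List A → M) (f : List A → A) :
    wordComp (c • F) f = c • wordComp F f := by
  ext w; simp [-zsmul_eq_mul, wordComp, smul_splitSum, smul_smul, mul_comm]

theorem add_wordBrace (F G : List A → M) (f g : List A → A) :
    wordBrace (F + G) f g = wordBrace F f g + wordBrace G f g := by
  ext w; simp [-zsmul_eq_mul, wordBrace, splitSum_add]

theorem smul_wordBrace (c : ℤ) (F : List A → M) (f g : List A → A) :
    wordBrace (c • F) f g = c • wordBrace F f g := by
  ext w; simp [-zsmul_eq_mul, wordBrace, smul_splitSum, smul_smul, mul_comm]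

theorem wordBrace_smul_left {F : List A → M} (hF : WordMultilinear k F) (c : ℤ)
    (f g : List A → A) : wordBrace F (c • f) g = c • wordBrace F f g := by
  ext w; simp [-zsmul_eq_mul, wordBrace, hF.map_zsmul, smul_splitSum, smul_smul, mul_comm]

theorem wordBrace_smul_right {F : List A → M} (hF : WordMultilinear k F) (c : ℤ)
    (f g : List A → A) : wordBrace F f (c • g) = c • wordBrace F f g := by
  ext w; simp [-zsmul_eq_mul, wordBrace, hF.map_zsmul₂, smul_splitSum, smul_smul, mul_comm]

/-- The Gerstenhaber bracket of functions of words of parities `p` and `q`. -/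
def wordBracket (p q : ℕ) (F G : List A → A) : List A → A :=
  (-1 : ℤ) ^ ((p + 1) * (q + 1)) • wordComp F G - wordComp G F

theorem wordDiff_wordCup {F G : List A → A} {p q : ℕ} (hF : HasWordParity p F)
    (hG : HasWordParity q G) (hG' : WordMultilinear k G) :
    wordDiff (wordCup F G) =
      wordCup (wordDiff F) G + (-1 : ℤ) ^ p • wordCup F (wordDiff G) := by
  rw [wordDiff_eq hF, wordDiff_eq hG, wordDiff_eq (hF.cup hG),
    wordCup_wordComp hF hG' hasWordParity_wordMul]
  simp only [sub_eq_add_neg, ← neg_one_zsmul (wordComp _ _), wordCup_add, add_wordCup,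
    wordCup_smul, smul_wordCup, wordCup_assoc]
  rcases neg_one_pow_eq_or ℤ p with h | h <;> rcases neg_one_pow_eq_or ℤ q with h' | h' <;>
    simp [pow_add, pow_mul, h, h'] <;> abel

/-- The pre-Lie identity applied to the multiplication, and twice to `F`. The braces in `F` cancel,
while the two braces of the multiplication remain as cup products in both orders. On cocycles this
is homotopy commutativity of the cup product. -/
theorem wordDiff_wordComp {F G : List A → A} {p q : ℕ} (hF : HasWordParity p F)
    (hF' : WordMultilinear k F) (hG : HasWordParity q G) :
    wordDiff (wordComp F G) = (-1 : ℤ) ^ (q + 1) • wordComp (wordDiff F) G +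
      wordComp F (wordDiff G) +
      ((-1 : ℤ) ^ q • wordCup G F - (-1 : ℤ) ^ (q + p * q) • wordCup F G) := by
  have h1 := wordComp_wordComp (wordMultilinear_wordMul (k := k) (A := A)) hF hG
  have h2 := wordComp_wordComp hF' hasWordParity_wordMul hG
  have h3 := wordComp_wordComp hF' hG hasWordParity_wordMul
  rw [wordBrace_wordMul hF hG, wordBrace_wordMul hG hF] at h1
  rw [wordDiff_eq_wordComp hF, wordDiff_eq_wordComp hG, wordDiff_eq_wordComp (hF.comp hF' hG)]
  simp only [sub_eq_add_neg, ← neg_one_zsmul (wordComp _ _), wordComp_add hF',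
    wordComp_smul hF', smul_wordComp, add_wordComp, h1, h2, h3]
  rcases neg_one_pow_eq_or ℤ p with h | h <;> rcases neg_one_pow_eq_or ℤ q with h' | h' <;>
    simp [pow_add, pow_mul, h, h'] <;> abel

/-- The homotopy which makes the bracket a derivation of the cup product on cohomology. -/
theorem wordDiff_wordBrace {F f g : List A → A} {r p q : ℕ} (hF : HasWordParity r F)
    (hF' : WordMultilinear k F) (hf : HasWordParity p f) (hf' : WordMultilinear k f)
    (hg : HasWordParity q g) (hg' : WordMultilinear k g)
    (hFp : HasWordParity (r + p + q) (wordBrace F f g))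
    (dF : wordDiff F = 0) (df : wordDiff f = 0) (dg : wordDiff g = 0) :
    wordBracket r (p + q) F (wordCup f g) =
      wordCup (wordBracket r p F f) g + (-1 : ℤ) ^ ((r + 1) * p) • wordCup f (wordBracket r q F g) +
      (-1 : ℤ) ^ ((r + 1) * (p + q + 1) + p * q + q) • wordDiff (wordBrace F f g) := by
  have h1 := wordBrace_wordComp hF' hf hf' hg hasWordParity_wordMul
  have h2 := wordBrace_of_wordComp hF' hf hg hasWordParity_wordMul wordMultilinear_wordMul
  -- The cocycle conditions trade insertion of the multiplication for outer products: for `F` in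
  -- terms of cups with the identity, for `f` and `g` in terms of insertion into the multiplication.
  have e1 : wordComp F wordMul = wordCup wordId F + (-1 : ℤ) ^ (r + 1) • wordCup F wordId := by
    rw [wordDiff_eq hF] at dF
    rw [sub_add_eq_add_sub] at dF
    exact (sub_eq_zero.1 dF).symm
  have e2 : wordComp f wordMul = (-1 : ℤ) ^ (p + 1) • wordComp wordMul f := by
    rw [wordDiff_eq_wordComp hf] at df
    exact (sub_eq_zero.1 df).symm
  have e3 : wordComp g wordMul = (-1 : ℤ) ^ (q + 1) • wordComp wordMul g := by
    rw [wordDiff_eq_wordComp hg] at dg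
    exact (sub_eq_zero.1 dg).symm
  rw [e2, e3, wordBrace_smul_left hF', wordBrace_smul_right hF'] at h1
  -- Distributing the brace over the cups with the identity produces `f ⌣ (F ∘ g)` and `(F ∘ f) ⌣
  -- g`, together with the outer terms of the differential of `F{f, g}`. The brace of the
  -- multiplication contributes `F ∘ (f ⌣ g)`.
  rw [wordBrace_wordMul hf hg, wordComp_smul hF', e1, add_wordBrace, smul_wordBrace,
    wordCup_wordBrace hasWordParity_wordId wordMultilinear_wordId hF' hf hg,
    wordCup_wordBrace hF hF' wordMultilinear_wordId hf hg, wordBrace_wordId, wordComp_wordId,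
    wordComp_wordId] at h2
  rw [wordDiff_eq hFp, h1]
  simp only [wordBracket]
  rw [wordCup_wordComp hf hg' hF]
  simp only [sub_eq_add_neg, ← neg_one_zsmul (wordComp _ _), wordCup_add, add_wordCup,
    wordCup_smul, smul_wordCup, wordCup_zero, zero_wordCup, zero_add, add_zero] at h2 ⊢
  rcases neg_one_pow_eq_or ℤ p with h | h <;> rcases neg_one_pow_eq_or ℤ q with h' | h' <;>
    rcases neg_one_pow_eq_or ℤ r with h'' | h'' <;>
    simp [pow_add, pow_mul, h, h', h''] at h2 ⊢ <;>
    first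
    | (linear_combination (norm := abel1) h2)
    | linear_combination (norm := abel1) -h2

/-- The commutator of a pre-Lie product is a Lie bracket: all double insertions are expanded and the
braces cancel in pairs. -/
theorem wordBracket_jacobi {F G H : List A → A} {p q r : ℕ} (hF : HasWordParity p F)
    (hF' : WordMultilinear k F) (hG : HasWordParity q G) (hG' : WordMultilinear k G)
    (hH : HasWordParity r H) (hH' : WordMultilinear k H) :
    wordBracket p (q + r + 1) F (wordBracket q r G H) =
      wordBracket (p + q + 1) r (wordBracket p q F G) H +
        (-1 : ℤ) ^ ((p + 1) * (q + 1)) •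
          wordBracket q (p + r + 1) G (wordBracket p r F H) := by
  have h1 := wordComp_wordComp hF' hG hH
  have h2 := wordComp_wordComp hF' hH hG
  have h3 := wordComp_wordComp hG' hF hH
  have h4 := wordComp_wordComp hG' hH hF
  have h5 := wordComp_wordComp hH' hF hG
  have h6 := wordComp_wordComp hH' hG hF
  simp only [wordBracket, sub_eq_add_neg, ← neg_one_zsmul (wordComp _ _), wordComp_add hF',
    wordComp_smul hF', wordComp_add hG', wordComp_smul hG', wordComp_add hH',
    wordComp_smul hH', smul_wordComp, add_wordComp, h1, h2, h3, h4, h5, h6]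
  rcases neg_one_pow_eq_or ℤ p with h | h <;> rcases neg_one_pow_eq_or ℤ q with h' | h' <;>
    rcases neg_one_pow_eq_or ℤ r with h'' | h'' <;>
    simp [pow_add, pow_mul, h, h', h''] <;> abel

/-- For even `p` the two braces in the pre-Lie identity for `F, F, F` have opposite signs, so `(F ∘
F) ∘ F = F ∘ (F ∘ F)`. No division by 3 is involved. -/
theorem wordBracket_jacobi_self {F : List A → A} {p : ℕ} (hp : Even p) (hF : HasWordParity p F)
    (hF' : WordMultilinear k F) :
    wordBracket p (p + p + 1) F (wordBracket p p F F) = 0 := by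
  have h1 := wordComp_wordComp hF' hF hF
  have h : (-1 : ℤ) ^ p = 1 := hp.neg_one_pow
  simp only [wordBracket, sub_eq_add_neg, ← neg_one_zsmul (wordComp _ _), wordComp_add hF',
    wordComp_smul hF', smul_wordComp, add_wordComp, h1]
  simp [pow_add, pow_mul, h]

end Words

/-! ### Multilinearity of cups, insertions and braces -/

section Words

variable {k A M N : Type*} [CommRing k] [Ring A] [Algebra k A] [AddCommGroup M] [Module k M]
  [AddCommGroup N] [Module k N]

theorem IsLinearMap.splitSum {α : Type*} {φ : List α → List α → M → N} (w : List α)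
    (h : ∀ u v, IsLinearMap k (φ u v)) : IsLinearMap k fun a => splitSum w fun u v => φ u v a where
  map_add a b := by simp only [(h _ _).map_add, splitSum_add]
  map_smul c a := by simp only [(h _ _).map_smul, smul_splitSum]

theorem IsLinearMap.zsmul {f : M → N} (n : ℤ) (h : IsLinearMap k f) :
    IsLinearMap k fun a => n • f a where
  map_add a b := by simp only [h.map_add, smul_add]
  map_smul c a := by simp only [h.map_smul, smul_comm c]

theorem IsLinearMap.add' {f g : M → N} (hf : IsLinearMap k f) (hg : IsLinearMap k g) :
    IsLinearMap k fun a => f a + g a where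
  map_add a b := by simp only [hf.map_add, hg.map_add]; abel
  map_smul c a := by simp only [hf.map_smul, hg.map_smul, smul_add]

namespace WordMultilinear

variable {F G : List A → M}

theorem zero : WordMultilinear k (0 : List A → M) := fun _ _ => by
  constructor <;> intros <;> simp

theorem add (hF : WordMultilinear k F) (hG : WordMultilinear k G) :
    WordMultilinear k (F + G) :=
  fun u v => (hF u v).add' (hG u v)

theorem zsmul (n : ℤ) (hF : WordMultilinear k F) : WordMultilinear k (n • F) :=
  fun u v => (hF u v).zsmul n

theorem neg (hF : WordMultilinear k F) : WordMultilinear k (-F) := by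
  simpa using hF.zsmul (-1)

theorem sub (hF : WordMultilinear k F) (hG : WordMultilinear k G) :
    WordMultilinear k (F - G) := by
  simpa [sub_eq_add_neg] using hF.add hG.neg

theorem append (hF : WordMultilinear k F) (u v : List A) :
    WordMultilinear k fun w => F (u ++ (w ++ v)) := fun s t => by
  simpa using hF (u ++ s) (t ++ v)

theorem append_left (hF : WordMultilinear k F) (u : List A) :
    WordMultilinear k fun w => F (u ++ w) := by
  simpa using hF.append u []

theorem append_right (hF : WordMultilinear k F) (v : List A) :
    WordMultilinear k fun w => F (w ++ v) := by
  simpa using hF.append [] v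

/-- The signs depend only on lengths of blocks, hence are constant while one letter varies. -/
theorem length_smul (hF : WordMultilinear k F) (c : ℕ → ℤ) :
    WordMultilinear k fun w => c w.length • F w := fun u v => by
  simpa using (hF u v).zsmul (c (u.length + (v.length + 1)))

theorem comp_isLinearMap (hF : WordMultilinear k F) {L : M → N} (hL : IsLinearMap k L) :
    WordMultilinear k fun w => L (F w) := fun u v =>
  { map_add := fun a b => by simp only [(hF u v).map_add, hL.map_add]
    map_smul := fun c a => by simp only [(hF u v).map_smul, hL.map_smul] }

theorem insert (hF : WordMultilinear k F) {f : List A → A} (hf : WordMultilinear k f)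
    (u v : List A) : WordMultilinear k fun w => F (u ++ f w :: v) :=
  hf.comp_isLinearMap (hF u v)

theorem splitSum_const {α : Type*} {φ : List α → List α → List A → M} (x : List α)
    (h : ∀ u v, WordMultilinear k (φ u v)) :
    WordMultilinear k fun w => splitSum x fun u v => φ u v w :=
  fun s t => IsLinearMap.splitSum x fun u v => h u v s t

theorem splitSum {φ : List A → List A → M} (h₁ : ∀ v, WordMultilinear k fun u => φ u v)
    (h₂ : ∀ u, WordMultilinear k fun v => φ u v) :
    WordMultilinear k fun w => splitSum w φ := fun u v => by
  simp only [splitSum_append_cons]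
  exact (IsLinearMap.splitSum u fun s t => h₂ s t v).add'
    (IsLinearMap.splitSum v fun s t => h₁ t u s)

end WordMultilinear

theorem WordMultilinear.cup {F G : List A → A} (hF : WordMultilinear k F)
    (hG : WordMultilinear k G) : WordMultilinear k (wordCup F G) :=
  .splitSum (fun v => hF.comp_isLinearMap (L := fun a => a * G v)
      ⟨fun _ _ => add_mul _ _ _, fun _ _ => smul_mul_assoc _ _ _⟩)
    (fun u => hG.comp_isLinearMap (L := fun a => F u * a)
      ⟨fun _ _ => mul_add _ _ _, fun _ _ => mul_smul_comm _ _ _⟩)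

theorem WordMultilinear.comp {F : List A → M} {g : List A → A} (hF : WordMultilinear k F)
    (hg : WordMultilinear k g) : WordMultilinear k (wordComp F g) := by
  refine .splitSum (fun x => ?_) fun u => .splitSum (fun z => ?_) fun v => ?_
  · exact .splitSum_const x fun v z => (hF.append_right (g v :: z)).length_smul
      fun n => (-1 : ℤ) ^ ((v.length + 1) * n)
  · exact (hF.insert hg u z).length_smul fun n => (-1 : ℤ) ^ ((n + 1) * u.length)
  · convert (hF.append_left (u ++ [g v])).zsmul ((-1 : ℤ) ^ ((v.length + 1) * u.length)) using 2
    simp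

theorem WordMultilinear.brace {F : List A → M} {f g : List A → A} (hF : WordMultilinear k F)
    (hf : WordMultilinear k f) (hg : WordMultilinear k g) :
    WordMultilinear k (wordBrace F f g) := by
  refine .splitSum (fun x => ?_) fun u => .splitSum (fun y => ?_) fun v => .splitSum (fun z => ?_)
    fun s => .splitSum (fun r => ?_) fun t => ?_
  · exact .splitSum_const _ fun v y => .splitSum_const _ fun s z => .splitSum_const _ fun t r =>
      (hF.append_right (f v :: (s ++ g t :: r))).length_smul fun n => (-1 : ℤ) ^
        ((v.length + 1) * n + (t.length + 1) * (n + v.length + s.length))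
  · exact .splitSum_const _ fun s z => .splitSum_const _ fun t r =>
      (hF.insert hf u (s ++ g t :: r)).length_smul fun n => (-1 : ℤ) ^
        ((n + 1) * u.length + (t.length + 1) * (u.length + n + s.length))
  · refine .splitSum_const _ fun t r => ?_
    convert (hF.append (u ++ [f v]) (g t :: r)).length_smul fun n => (-1 : ℤ) ^
        ((v.length + 1) * u.length + (t.length + 1) * (u.length + v.length + n)) using 3
    simp
  · convert (hF.insert hg (u ++ f v :: s) r).length_smul fun n => (-1 : ℤ) ^
        ((v.length + 1) * u.length + (n + 1) * (u.length + v.length + s.length)) using 3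
    simp
  · convert (hF.append_left (u ++ f v :: (s ++ [g t]))).zsmul ((-1 : ℤ) ^
        ((v.length + 1) * u.length + (t.length + 1) * (u.length + v.length + s.length))) using 2
    simp

theorem HasWordParity.brace {F f g : List A → A} {r p q : ℕ} (hF : HasWordParity r F)
    (hF' : WordMultilinear k F) (hf : HasWordParity p f) (hg : HasWordParity q g) :
    HasWordParity (r + p + q) (wordBrace F f g) := by
  intro w
  by_cases h : Even w.length ↔ Even (r + p + q)
  · exact .inr h
  refine .inl (splitSum_eq_zero fun u x hx => splitSum_eq_zero fun v y hy =>
    splitSum_eq_zero fun s z hz => splitSum_eq_zero fun t a ha => ?_)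
  rcases hf v with h1 | h1
  · simp [h1, hF'.map_zero]
  rcases hg t with h2 | h2
  · simp [h2, hF'.map_zero₂]
  rcases hF (u ++ f v :: (s ++ g t :: a)) with h3 | h3
  · simp [h3]
  subst ha hz hy hx
  simp only [List.length_append, List.length_cons, parity_simps] at h h1 h2 h3
  grind

end Words

/-! ### Cochains as functions of words -/

section Translation

variable {k A : Type*} [CommRing k] [Ring A] [Algebra k A]

/-- A cochain as a function of words which vanishes on words of other lengths. -/
def wordOf {n : ℕ} (f : HochschildCochain k A n) (w : List A) : A :=
  if w.length = n then f fun i => w.getD i 0 else 0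

theorem wordOf_of_length {n : ℕ} (f : HochschildCochain k A n) {w : List A} (h : w.length = n) :
    wordOf f w = f fun i => w.getD i 0 := if_pos h

theorem wordOf_of_ne {n : ℕ} (f : HochschildCochain k A n) {w : List A} (h : w.length ≠ n) :
    wordOf f w = 0 := if_neg h

theorem wordOf_ofFn {n : ℕ} (f : HochschildCochain k A n) (a : Fin n → A) :
    wordOf f (List.ofFn a) = f a := by
  rw [wordOf_of_length f (List.length_ofFn)]
  congr 1
  ext i
  simp

theorem eq_of_wordOf {n : ℕ} {f g : HochschildCochain k A n}
    (h : ∀ w : List A, w.length = n → wordOf f w = wordOf g w) : f = g := by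
  ext a
  rw [← wordOf_ofFn, ← wordOf_ofFn]
  exact h _ List.length_ofFn

theorem wordOf_injective {n : ℕ} : Function.Injective (wordOf (k := k) (A := A) (n := n)) :=
  fun _ _ h => eq_of_wordOf fun w _ => congrFun h w

theorem hasWordParity_wordOf {n : ℕ} (f : HochschildCochain k A n) :
    HasWordParity n (wordOf f) := by
  intro w
  by_cases h : w.length = n
  · simp [h]
  · exact .inl (wordOf_of_ne f h)

theorem wordMultilinear_wordOf {n : ℕ} (f : HochschildCochain k A n) :
    WordMultilinear k (wordOf f) := by
  intro u v
  by_cases h : (u ++ 0 :: v).length = n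
  · have key (a : A) : wordOf f (u ++ a :: v) =
        f (Function.update (fun i : Fin n => (u ++ 0 :: v).getD i 0)
          ⟨u.length, by simp at h; omega⟩ a) := by
      rw [wordOf_of_length f (by simpa using h)]
      congr 1
      ext i
      rw [Function.update_apply]
      split_ifs with hi
      · simp [hi]
      · have : (i : ℕ) ≠ u.length := fun h' => hi (Fin.ext h')
        rcases lt_or_gt_of_ne this with h' | h'
        · simp [List.getElem?_append_left h']
        · obtain ⟨j, hj⟩ := Nat.exists_eq_add_of_lt h'
          rw [hj]
          simp [List.getElem?_append_right, add_assoc]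
    constructor
    · intro x y; simp only [key, MultilinearMap.map_update_add]
    · intro x y; simp only [key, MultilinearMap.map_update_smul]
  · have key (a : A) : wordOf f (u ++ a :: v) = 0 := wordOf_of_ne f (by simpa using h)
    constructor <;> simp [key]

theorem wordOf_add {n : ℕ} (f g : HochschildCochain k A n) :
    wordOf (f + g) = wordOf f + wordOf g := by
  ext w
  by_cases h : w.length = n <;> simp [wordOf, h]

theorem wordOf_sub {n : ℕ} (f g : HochschildCochain k A n) :
    wordOf (f - g) = wordOf f - wordOf g := by
  ext w
  by_cases h : w.length = n <;> simp [wordOf, h]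

theorem wordOf_smul {n : ℕ} (c : k) (f : HochschildCochain k A n) :
    wordOf (c • f) = c • wordOf f := by
  ext w
  by_cases h : w.length = n <;> simp [wordOf, h]

theorem wordOf_neg_one_pow_smul {n : ℕ} (m : ℕ) (f : HochschildCochain k A n) :
    wordOf ((-1 : k) ^ m • f) = (-1 : ℤ) ^ m • wordOf f := by
  rw [wordOf_smul]
  rcases neg_one_pow_eq_or ℤ m with h | h
  · have h' : (-1 : k) ^ m = 1 := by exact_mod_cast congrArg (Int.cast : ℤ → k) h
    rw [h, h', one_smul, one_smul]
  · have h' : (-1 : k) ^ m = -1 := by exact_mod_cast congrArg (Int.cast : ℤ → k) h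
    rw [h, h', neg_one_smul, neg_one_smul]

theorem wordOf_zero {n : ℕ} : wordOf (0 : HochschildCochain k A n) = 0 := by
  ext w
  by_cases h : w.length = n <;> simp [wordOf, h]

theorem wordOf_id : wordOf (HochschildCochain.id k A) = wordId := by
  ext w
  rcases w with _ | ⟨a, _ | ⟨b, w⟩⟩ <;> simp [wordOf, wordId, HochschildCochain.id]

theorem wordOf_mul : wordOf (HochschildCochain.mul k A) = wordMul := by
  ext w
  rcases w with _ | ⟨a, _ | ⟨b, _ | ⟨c, w⟩⟩⟩ <;>
    simp [wordOf, wordMul, HochschildCochain.mul]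

theorem wordOf_one : wordOf (HochschildCochain.one k A) = wordOne := by
  ext w
  rcases w with _ | ⟨a, w⟩ <;> simp [wordOf, wordOne, HochschildCochain.one]

theorem wordOf_cup {p q n : ℕ} (h : p + q = n) (f : HochschildCochain k A p)
    (g : HochschildCochain k A q) :
    wordOf (HochschildCochain.cup h f g) = wordCup (wordOf f) (wordOf g) := by
  ext w
  by_cases hw : w.length = n
  · rw [wordOf_of_length _ hw, HochschildCochain.cup_apply, wordCup, splitSum,
      -- A cut contributes only if its first part has length `p`.
      Finset.sum_eq_single_of_mem p (by simp; omega)]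
    · rw [wordOf_of_length f (by simp; omega), wordOf_of_length g (by simp; omega)]
      congr 2
      · ext i; simp [List.getElem?_take]
      · ext i; simp
    · intro i hi hip
      rw [wordOf_of_ne f (by simp at hi ⊢; omega), zero_mul]
  · rw [wordOf_of_ne _ hw]
    refine (splitSum_eq_zero fun u v huv => ?_).symm
    by_cases hu : u.length = p
    · rw [wordOf_of_ne g, mul_zero]
      rw [← huv, List.length_append] at hw
      omega
    · rw [wordOf_of_ne f hu, zero_mul]

theorem wordOf_insert {p q n : ℕ} (h : p + q = n + 1) (i : Fin p) (f : HochschildCochain k A p)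
    (g : HochschildCochain k A q) {w : List A} (hw : w.length = n) :
    wordOf (HochschildCochain.insert h i f g) w =
      wordOf f (w.take i ++ wordOf g ((w.drop i).take q) :: (w.drop i).drop q) := by
  rw [wordOf_of_length _ hw, HochschildCochain.insert_apply, wordOf_of_length f (by simp; omega),
    wordOf_of_length g (by simp; omega)]
  congr 1
  ext j
  simp only [HochschildCochain.insertArgs]
  have hi : min (i : ℕ) w.length = i := by omega
  split_ifs with h1 h2
  · have hj : (j : ℕ) < w.length := by omega
    simp [List.getElem?_append, h1, hi, List.getElem?_take, List.getElem?_eq_getElem hj]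
  · rw [List.getD_eq_getElem?_getD, List.getElem?_append_right (by simp; omega)]
    simp [h2, hi, List.getElem?_take]
  · rw [List.getD_eq_getElem?_getD, List.getD_eq_getElem?_getD,
      List.getElem?_append_right (by simp; omega)]
    obtain ⟨m, hm⟩ := Nat.exists_eq_add_of_lt (show (i : ℕ) < j by omega)
    have : (j : ℕ) - i = m + 1 := by omega
    simp only [List.length_take, hi, this, List.getElem?_cons_succ, List.drop_drop,
      List.getElem?_drop]
    congr 2
    omega

theorem wordOf_sum_insert {p q n : ℕ} (h : p + q = n + 1) (f : HochschildCochain k A p)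
    (g : HochschildCochain k A q) :
    wordOf (∑ i : Fin p, (-1 : k) ^ ((q + 1) * i.val) • HochschildCochain.insert h i f g) =
      wordComp (wordOf f) (wordOf g) := by
  have hsum (w : List A) : wordOf (∑ i : Fin p, (-1 : k) ^ ((q + 1) * i.val) •
      HochschildCochain.insert h i f g) w = ∑ i : Fin p, (-1 : ℤ) ^ ((q + 1) * i.val) •
        wordOf (HochschildCochain.insert h i f g) w := by
    have := map_sum (⟨⟨wordOf, wordOf_zero⟩, wordOf_add⟩ :
      HochschildCochain k A n →+ (List A → A)) (fun i : Fin p => (-1 : k) ^ ((q + 1) * i.val) •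
        HochschildCochain.insert h i f g) Finset.univ
    simp only [AddMonoidHom.coe_mk, ZeroHom.coe_mk] at this
    rw [this, Finset.sum_apply]
    simp only [wordOf_neg_one_pow_smul, Pi.smul_apply]
  ext w
  rw [hsum]
  by_cases hw : w.length = n
  · simp only [wordOf_insert h _ f g hw]
    rw [wordComp, splitSum, Fin.sum_univ_eq_sum_range (fun i => (-1 : ℤ) ^ ((q + 1) * i) •
      wordOf f (w.take i ++ wordOf g ((w.drop i).take q) :: (w.drop i).drop q)) p]
    -- A word of length `n` has `n + 1` cuts, and `p ≤ n + 1`. Cuts at `p` or later feed `f` more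
    -- than `p` letters and vanish.
    refine Eq.trans ?_ (Finset.sum_subset (s₁ := Finset.range p) ?_ ?_)
    · refine Finset.sum_congr rfl fun i hi => ?_
      simp only [Finset.mem_range] at hi
      rw [splitSum, Finset.sum_eq_single_of_mem q (by simp; omega)]
      · have h1 : (w.take i).length = i := by simp; omega
        have h2 : ((w.drop i).take q).length = q := by simp; omega
        rw [h1, h2]
      · intro j hj hjq
        rw [wordOf_of_ne f, smul_zero]
        simp at hj ⊢; omega
    · intro i hi
      simp only [Finset.mem_range] at hi ⊢
      omega
    · intro i hi hip
      refine splitSum_eq_zero fun u v _ => ?_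
      rw [wordOf_of_ne f, smul_zero]
      simp at hi hip ⊢; omega
  · have h1 (i : Fin p) : wordOf (HochschildCochain.insert h i f g) w = 0 := wordOf_of_ne _ hw
    simp only [h1, smul_zero, Finset.sum_const_zero]
    refine (splitSum_eq_zero fun u x hx => splitSum_eq_zero fun v z hz => ?_).symm
    by_cases hv : v.length = q
    · rw [wordOf_of_ne f, smul_zero]
      subst hz hx
      simp at hw ⊢; omega
    · rw [wordOf_of_ne g hv, (wordMultilinear_wordOf f).map_zero, smul_zero]

theorem wordOf_bracket {p q n : ℕ} (h : p + q = n + 1) (f : HochschildCochain k A p)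
    (g : HochschildCochain k A q) :
    wordOf (HochschildCochain.bracket h f g) = wordBracket p q (wordOf f) (wordOf g) := by
  simp only [HochschildCochain.bracket, HochschildCochain.comp, wordOf_sub,
    wordOf_neg_one_pow_smul, wordOf_sum_insert, wordBracket]
  rw [smul_smul, ← pow_add, mul_comm (q + 1), Even.neg_one_pow ⟨_, rfl⟩, one_smul]

theorem wordOf_differential {n : ℕ} (f : HochschildCochain k A n) :
    wordOf (HochschildCochain.differential k A n f) = wordDiff (wordOf f) := by
  have h : (∑ i : Fin n, (-1 : k) ^ (i.val + 1) • HochschildCochain.insert (q := 2)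
      (n := n + 1) rfl i f (HochschildCochain.mul k A)) = (-1 : k) ^ 1 •
        ∑ i : Fin n, (-1 : k) ^ ((2 + 1) * i.val) • HochschildCochain.insert (q := 2)
      (n := n + 1) rfl i f (HochschildCochain.mul k A) := by
    rw [Finset.smul_sum]
    refine Finset.sum_congr rfl fun i _ => ?_
    rw [smul_smul, ← pow_add]
    congr 1
    rw [_root_.neg_one_pow_congr]
    simp only [parity_simps]
    grind
  change wordOf (HochschildCochain.differentialFun f) = _
  rw [HochschildCochain.differentialFun, h, wordOf_add, wordOf_add, wordOf_neg_one_pow_smul,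
    wordOf_neg_one_pow_smul, wordOf_sum_insert, wordOf_cup, wordOf_cup, wordOf_id, wordOf_mul,
    wordDiff_eq (hasWordParity_wordOf f)]
  simp [sub_eq_add_neg]

theorem List.ofFn_update {α : Type*} {n : ℕ} (a : Fin n → α) (m : Fin n) (x : α) :
    List.ofFn (Function.update a m x) =
      (List.ofFn a).take m ++ x :: (List.ofFn a).drop (m + 1) := by
  have h := List.set_eq_take_append_cons_drop (l := List.ofFn a) (i := m) (a := x)
  rw [if_pos (by simp)] at h
  rw [← h]
  apply List.ext_getElem
  · simp
  · intro i h1 h2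
    simp only [List.getElem_ofFn, List.getElem_set, Function.update_apply, Fin.ext_iff, eq_comm]

/-- The cochain of degree `n` given by a multilinear function of words. -/
def cochainOf {F : List A → A} (hF : WordMultilinear k F) (n : ℕ) : HochschildCochain k A n :=
  MultilinearMap.mk' (fun a => F (List.ofFn a))
    (fun a m x y => by simp only [List.ofFn_update, hF.map_add])
    (fun a m c x => by simp only [List.ofFn_update, (hF _ _).map_smul])

theorem wordOf_cochainOf {F : List A → A} (hF : WordMultilinear k F) {w : List A} {n : ℕ}
    (h : w.length = n) : wordOf (cochainOf hF n) w = F w := by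
  subst h
  rw [wordOf_of_length _ rfl]
  change F _ = F w
  congr 1
  apply List.ext_getElem <;> simp

end Translation

/-! ### The Connes operator of a symmetrizing trace -/

section Trace

variable {k A M : Type*} [CommRing k] [Ring A] [Algebra k A] [AddCommGroup M] [Module k M]

theorem splitSum_eq_neg {α : Type*} {φ ψ : List α → List α → M} {w : List α}
    (h : ∀ u v, u ++ v = w → φ u v = -ψ u v) : splitSum w φ = -splitSum w ψ := by
  rw [← splitSum_neg]
  exact splitSum_congr h

theorem neg_one_pow_smul_eq_neg {m n : ℕ} (h : Even m ↔ ¬Even n) (x : M) :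
    (-1 : ℤ) ^ m • x = -((-1 : ℤ) ^ n • x) := by
  rw [neg_one_pow_smul_congr (n := n + 1) (by simp only [parity_simps, h]), pow_succ]
  simp

theorem wordId_append_cons (u z : List A) (c : A) :
    wordId (u ++ c :: z) = if u = [] then if z = [] then c else 0 else 0 := by
  rcases u with _ | ⟨a, _ | ⟨b, u⟩⟩ <;> rcases z with _ | ⟨d, z⟩ <;> simp [wordId]

theorem wordId_eq_zero_or (w : List A) : wordId w = 0 ∨ w.length = 1 := by
  rcases w with _ | ⟨a, _ | ⟨b, w⟩⟩ <;> simp [wordId]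

theorem wordMul_append_cons_eq_ite (u z : List A) (c : A) :
    wordMul (u ++ c :: z) = (if u = [] then c * wordId z else 0) +
      (if z = [] then wordId u * c else 0) := by
  rcases u with _ | ⟨a, _ | ⟨b, u⟩⟩ <;> rcases z with _ | ⟨d, _ | ⟨e, z⟩⟩ <;>
    simp [wordMul, wordId]

theorem wordComp_wordMul_right {F : List A → M} (hF : WordMultilinear k F) (w : List A) :
    wordComp F wordMul w = splitSum w fun u x => splitSum x fun v z =>
      (-1 : ℤ) ^ u.length • F (u ++ wordMul v :: z) := by
  refine splitSum_congr_all fun u _ => splitSum_congr_all fun v z => ?_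
  rcases hasWordParity_wordMul v with h | h
  · simp [h, hF.map_zero]
  refine neg_one_pow_smul_congr ?_ _
  simp only [parity_simps]
  grind

theorem splitSum_ite_left {α : Type*} (φ : List α → List α → M) (w : List α) :
    splitSum w (fun u v => if u = [] then φ u v else 0) = φ [] w := by
  rw [splitSum_eq_left] <;> simp

theorem splitSum_ite_right {α : Type*} (φ : List α → List α → M) (w : List α) :
    splitSum w (fun u v => if v = [] then φ u v else 0) = φ w [] := by
  rw [splitSum_eq_right] <;> simp

theorem splitSum_ite_const {α : Type*} (p : Prop) [Decidable p] (φ : List α → List α → M)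
    (w : List α) :
    splitSum w (fun u v => if p then φ u v else 0) = if p then splitSum w φ else 0 := by
  split_ifs
  · rfl
  · exact splitSum_zero w

theorem WordMultilinear.map_ite {F : List A → M} (hF : WordMultilinear k F) (u v : List A)
    (p : Prop) [Decidable p] (a : A) :
    F (u ++ (if p then a else 0) :: v) = if p then F (u ++ a :: v) else 0 := by
  split_ifs
  · rfl
  · exact hF.map_zero u v

/-- A trace form on `A` which identifies `A` with its dual. -/
structure IsSymmetrizingTrace (tr : A →ₗ[k] k) : Prop where
  comm : ∀ a b, tr (a * b) = tr (b * a)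
  exists_eq : ∀ φ : A →ₗ[k] k, ∃ b, ∀ a, tr (a * b) = φ a
  ext : ∀ b c, (∀ a, tr (a * b) = tr (a * c)) → b = c

/-- The trace is the image of `1`. Bimodule linearity on the two sides gives `e x y = tr (x * y)`
and `e x y = tr (y * x)`, hence symmetry; bijectivity of `e` gives existence and uniqueness of
representing elements. -/
theorem AlgebraIsSymmetric.exists_trace (h : AlgebraIsSymmetric k A) :
    ∃ tr : A →ₗ[k] k, IsSymmetrizingTrace tr := by
  obtain ⟨e, he⟩ := h
  have h1 (x y : A) : e x y = e 1 (x * y) := by simpa using he 1 1 x y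
  have h2 (x y : A) : e x y = e 1 (y * x) := by simpa using he x 1 1 y
  refine ⟨e 1, fun a b => by rw [← h1, h2], fun φ => ⟨e.symm φ, fun a => ?_⟩, fun b c h => ?_⟩
  · rw [← h2, e.apply_symm_apply]
  · apply e.injective
    ext a
    rw [h2 b, h2 c, h]

/-- The element of `A` which represents a linear form `φ` with respect to a trace form. -/
noncomputable def traceRep (tr : A →ₗ[k] k) (φ : A → k) : A :=
  open Classical in if h : ∃ b, ∀ a, tr (a * b) = φ a then h.choose else 0

/-- The Connes operator on Hochschild cochains, as an operator on functions of words. -/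
noncomputable def wordConnes (tr : A →ₗ[k] k) (f : List A → A) (w : List A) : A :=
  traceRep tr fun a => splitSum w fun u v =>
    (-1 : ℤ) ^ (v.length * (u.length + 1)) • tr (f (v ++ a :: u))

namespace IsSymmetrizingTrace

variable {tr : A →ₗ[k] k} (ht : IsSymmetrizingTrace tr)
include ht

theorem mul_traceRep {φ : A → k} (hφ : IsLinearMap k φ) (a : A) :
    tr (a * traceRep tr φ) = φ a := by
  have h : ∃ b, ∀ a, tr (a * b) = φ a := ht.exists_eq hφ.mk'
  rw [traceRep, dif_pos h]
  exact h.choose_spec a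

/-- Although representing elements are chosen, nondegeneracy makes them unique, so they depend
linearly on the form. -/
theorem wordMultilinear_traceRep {Φ : List A → A → k} (h₁ : ∀ w, IsLinearMap k (Φ w))
    (h₂ : ∀ a, WordMultilinear k fun w => Φ w a) :
    WordMultilinear k fun w => traceRep tr (Φ w) := fun u v =>
  { map_add := fun x y => ht.ext _ _ fun a => by
      rw [mul_add, map_add, ht.mul_traceRep (h₁ _), ht.mul_traceRep (h₁ _),
        ht.mul_traceRep (h₁ _)]
      exact (h₂ a u v).map_add x y
    map_smul := fun c x => ht.ext _ _ fun a => by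
      rw [mul_smul_comm, map_smul, ht.mul_traceRep (h₁ _), ht.mul_traceRep (h₁ _)]
      exact (h₂ a u v).map_smul c x }

theorem mul_wordConnes {f : List A → A} (hf : WordMultilinear k f) (a : A) (w : List A) :
    tr (a * wordConnes tr f w) = splitSum w fun u v =>
      (-1 : ℤ) ^ (v.length * (u.length + 1)) • tr (f (v ++ a :: u)) :=
  ht.mul_traceRep (.splitSum w fun u v =>
    (((hf.comp_isLinearMap tr.isLinear) v u).zsmul _)) a

theorem wordMultilinear_wordConnes {f : List A → A} (hf : WordMultilinear k f) :
    WordMultilinear k (wordConnes tr f) := by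
  have hf' := hf.comp_isLinearMap tr.isLinear
  refine ht.wordMultilinear_traceRep (fun w => .splitSum w fun u v => (hf' v u).zsmul _)
    fun a => .splitSum (fun v => ?_) fun u => ?_
  · convert (hf'.append_left (v ++ [a])).length_smul fun n => (-1 : ℤ) ^ (v.length * (n + 1))
      using 4
    simp
  · exact (hf'.append_right (a :: u)).length_smul fun n => (-1 : ℤ) ^ (n * (u.length + 1))

/-- Under the trace pairing the two outer multiplications of the differential act on the dual
variable `a`. A function known only through its pairings can therefore be differentiated. -/
theorem mul_wordDiff {F : List A → A} (hF : WordMultilinear k F) {Φ : A → List A → k}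
    (h : ∀ a w, tr (a * F w) = Φ a w) (a : A) (w : List A) :
    tr (a * wordDiff F w) = splitSum w (fun u v => Φ (a * wordId u) v) -
      splitSum w (fun u x => splitSum x fun v z =>
        (-1 : ℤ) ^ u.length • Φ a (u ++ wordMul v :: z)) +
      splitSum w fun u v => (-1 : ℤ) ^ (u.length + 1) • Φ (wordId v * a) u := by
  rw [wordDiff, wordComp_wordMul_right hF]
  simp only [wordCup, mul_add, mul_sub, mul_splitSum, mul_smul_comm, map_add, map_sub,
    map_splitSum, map_zsmul]
  congr 1
  · congr 1
    · refine splitSum_congr_all fun u v => ?_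
      rw [← mul_assoc, h]
    · simp only [h]
  · refine splitSum_congr_all fun u v => ?_
    rw [← mul_assoc, ht.comm, ← mul_assoc, h]

/-- Dual to `b s N = -s N b`: products of neighbouring letters of the cyclic word match on both
sides, and the outer products in the differential of `f` cancel in pairs under rotation. -/
theorem wordDiff_wordConnes {f : List A → A} (hf : WordMultilinear k f)
    (hdf : WordMultilinear k (wordDiff f)) :
    wordDiff (wordConnes tr f) = -wordConnes tr (wordDiff f) := by
  ext w
  rw [Pi.neg_apply, ← add_eq_zero_iff_eq_neg]
  refine ht.ext _ _ fun a => ?_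
  have hf' := hf.comp_isLinearMap tr.isLinear
  rw [mul_add, map_add, ht.mul_wordDiff (ht.wordMultilinear_wordConnes hf) (ht.mul_wordConnes hf),
    ht.mul_wordConnes hdf, mul_zero, map_zero]
  simp only [wordDiff, wordComp_wordMul_right hf, wordCup, splitSum_append_cons, splitSum_add,
    wordId_append_cons, wordMul_append_cons_eq_ite, ite_mul, mul_ite, zero_mul, mul_zero,
    map_add, map_sub, map_splitSum, map_zsmul, smul_add, smul_sub, smul_splitSum, smul_smul,
    ← pow_add, List.append_assoc, List.cons_append, splitSum_sub, splitSum_assoc,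
    splitSum_assoc_right, splitSum_assoc_right₂, hf.map_add, hf.map_ite, apply_ite tr, map_zero,
    smul_ite, smul_zero, splitSum_ite_left, splitSum_ite_right, splitSum_ite_const]
  -- The `lᵢ` come from differentiating `Δf`, the `rᵢ` from applying `Δ` to the differential of `f`.
  -- `r₁, r₂` are the products with the first letter and `r₇, r₈` those with the last; cyclicity of
  -- the trace identifies them up to sign.
  have key : ∀ l₁ l₂ l₃ l₄ r₁ r₂ r₃ r₄ r₅ r₆ r₇ r₈ : k, l₁ = r₄ → l₂ = -r₃ → l₃ = -r₆ → l₄ = r₅ →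
      r₁ = -r₈ → r₂ = -r₇ → l₁ - (l₂ + l₃) + l₄ +
        (r₁ + r₂ - (r₃ + (r₄ + r₅) + r₆) + (r₇ + r₈)) = 0 := by
    intros
    subst_vars
    ring
  refine key _ _ _ _ _ _ _ _ _ _ _ _ ?_ ?_ ?_ ?_ ?_ ?_
  · refine splitSum_congr fun u x h => splitSum_congr fun v y h1 => ?_
    subst h1 h
    rcases wordId_eq_zero_or u with h0 | h0
    · simp [h0, hf.map_zero]
    refine neg_one_pow_smul_congr ?_ _
    simp only [List.length_append, List.length_cons, parity_simps, h0]
    grind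
  · refine splitSum_eq_neg fun u x h => splitSum_eq_neg fun v y h1 =>
      splitSum_eq_neg fun s z h2 => ?_
    subst h2 h1 h
    rcases hasWordParity_wordMul s with h0 | h0
    · simp [h0, hf.map_zero]
    refine neg_one_pow_smul_eq_neg ?_ _
    simp only [List.length_append, List.length_cons, parity_simps] at h0 ⊢
    grind
  · refine splitSum_eq_neg fun u x h => splitSum_eq_neg fun v y h1 =>
      splitSum_eq_neg fun s z h2 => ?_
    subst h2 h1 h
    rcases hasWordParity_wordMul v with h0 | h0
    · simp [h0, hf.map_zero₂]
    refine neg_one_pow_smul_eq_neg ?_ _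
    simp only [List.length_append, List.length_cons, parity_simps] at h0 ⊢
    grind
  · refine splitSum_congr fun u x h => splitSum_congr fun v y h1 => ?_
    subst h1 h
    rcases wordId_eq_zero_or y with h0 | h0
    · simp [h0, hf.map_zero]
    refine neg_one_pow_smul_congr ?_ _
    simp only [List.length_append, List.length_cons, parity_simps, h0]
    grind
  · refine splitSum_eq_neg fun u x h => splitSum_eq_neg fun v y h1 => ?_
    subst h1 h
    rcases wordId_eq_zero_or v with h0 | h0
    · simp [h0, hf.map_zero]
    rw [ht.comm]
    refine neg_one_pow_smul_eq_neg ?_ _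
    simp only [List.length_append, List.length_cons, parity_simps, h0]
    grind
  · rw [ht.comm]
    refine neg_one_pow_smul_eq_neg ?_ _
    simp only [List.length_nil, parity_simps]
    grind

end IsSymmetrizingTrace

end Trace

/-! ### The homotopy between the Connes operator and the bracket -/

section Trace

variable {k A M : Type*} [CommRing k] [Ring A] [Algebra k A] [AddCommGroup M] [Module k M]

/-- A homotopy which relates the failure of the Connes operator to be a derivation of the cup
product to the Gerstenhaber bracket. -/
noncomputable def wordBVHomotopy (tr : A →ₗ[k] k) (f g : List A → A) (w : List A) : A :=
  traceRep tr fun a => splitSum w fun s r => splitSum r fun t z => splitSum z fun y x =>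
    (-1 : ℤ) ^ ((y.length + 1) * (s.length + t.length) +
      (s.length + 1) * (t.length + x.length + 1)) • tr (f (t ++ g y :: (x ++ a :: s)))

theorem WordMultilinear.map_ite₂ {F : List A → M} (hF : WordMultilinear k F) (t u v : List A)
    (b : A) (p : Prop) [Decidable p] (a : A) :
    F (t ++ b :: (u ++ (if p then a else 0) :: v)) =
      if p then F (t ++ b :: (u ++ a :: v)) else 0 := by
  split_ifs
  · rfl
  · exact hF.map_zero₂ _ _ _ _

namespace IsSymmetrizingTrace

variable {tr : A →ₗ[k] k} (ht : IsSymmetrizingTrace tr)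
include ht

theorem mul_wordBVHomotopy {f g : List A → A} (hf : WordMultilinear k f) (a : A) (w : List A) :
    tr (a * wordBVHomotopy tr f g w) =
      splitSum w fun s r => splitSum r fun t z => splitSum z fun y x =>
    (-1 : ℤ) ^ ((y.length + 1) * (s.length + t.length) +
      (s.length + 1) * (t.length + x.length + 1)) • tr (f (t ++ g y :: (x ++ a :: s))) := by
  have hf' := hf.comp_isLinearMap tr.isLinear
  have h (s t x y : List A) : IsLinearMap k fun a => tr (f (t ++ g y :: (x ++ a :: s))) := by
    simpa only [List.append_assoc, List.cons_append] using hf' (t ++ g y :: x) s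
  exact ht.mul_traceRep (IsLinearMap.splitSum w fun s r => IsLinearMap.splitSum r fun t z =>
    IsLinearMap.splitSum z fun y x => (h s t x y).zsmul _) a

-- The homotopy sums over cyclic words `t, y, x, a, s` with `g` applied to `y`. The three surviving
-- sums are its boundary cases: `t` empty, where `g y` becomes an outer factor; `s` empty, where `a`
-- becomes an outer factor; `x` empty, where `g y` is multiplied with `a`.
set_option maxHeartbeats 1000000 in
theorem wordDiff_wordBVHomotopy {f g : List A → A} (hf : WordMultilinear k f)
    (hg : WordMultilinear k g) (hdf : wordDiff f = 0) (hdg : wordDiff g = 0)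
    (hh : WordMultilinear k (wordBVHomotopy tr f g)) (a : A) (w : List A) :
    tr (a * wordDiff (wordBVHomotopy tr f g) w) =
      (splitSum w fun s z => splitSum z fun y x =>
        (-1 : ℤ) ^ ((s.length + 1) * (y.length + x.length)) • tr (g y * f (x ++ a :: s))) +
      (splitSum w fun s z => splitSum z fun y x =>
        (-1 : ℤ) ^ (y.length + (y.length + 1) * s.length) • tr (a * f (s ++ g y :: x))) +
      splitSum w fun s r => splitSum r fun t y =>
        (-1 : ℤ) ^ (t.length + 1 + (y.length + 1) * (s.length + t.length + 1) +
          (s.length + 1) * (t.length + 1)) • tr (f (t ++ (g y * a) :: s)) := by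
  -- Bookkeeping of summands: the `aᵢ` come from the vanishing differential of `f`, the `bᵢ` from
  -- that of `g`, the `hᵢ` from the homotopy, and the `tᵢ` are the claimed terms. `a₁` and `a₁₂`
  -- cancel by moving a letter around the trace; `a₄, a₆` are the products of `g y` with a
  -- neighbouring letter and cancel against `b₃, b₁`.
  have key : ∀ a₁ a₂ a₃ a₄ a₅ a₆ a₇ a₈ a₉ a₁₀ a₁₁ a₁₂ b₁ b₂ b₃ h₀ h₁ h₂ h₃ h₄ h₅ t₁ t₂ t₃ : k,
      a₁ + a₂ - (a₃ + (a₄ + a₅ + a₆) + (a₇ + (a₈ + a₉) + a₁₀)) + (a₁₁ + a₁₂) = 0 →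
      b₁ - b₂ + b₃ = 0 → h₀ = a₈ → h₁ = -a₇ → h₂ = b₂ → h₃ = -a₃ → h₄ = -a₁₀ → h₅ = a₉ →
      t₁ = a₂ → t₂ = a₁₁ → t₃ = -a₅ → a₁ = -a₁₂ → a₆ = -b₁ → a₄ = -b₃ →
      h₀ - (h₁ + h₂ + h₃ + h₄) + h₅ = t₁ + t₂ + t₃ := by
    intro a₁ a₂ a₃ a₄ a₅ a₆ a₇ a₈ a₉ a₁₀ a₁₁ a₁₂ b₁ b₂ b₃ h₀ h₁ h₂ h₃ h₄ h₅ t₁ t₂ t₃ e₁ e₂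
    intros
    subst_vars
    linear_combination e₂ - e₁
  have e1 : (splitSum w fun s r => splitSum r fun t z => splitSum z fun y x =>
    (-1 : ℤ) ^ ((y.length + 1) * (s.length + t.length + 1) +
      (s.length + 1) * (t.length + x.length + 1)) • tr (wordDiff f (t ++ g y :: (x ++ a :: s))))
      = 0 := by
    simp only [hdf, Pi.zero_apply, map_zero, smul_zero, splitSum_zero]
  have e2 : (splitSum w fun s r => splitSum r fun t z => splitSum z fun y x =>
    (-1 : ℤ) ^ ((y.length + 1) * (s.length + t.length) +
      (s.length + 1) * (t.length + x.length + 1)) • tr (f (t ++ wordDiff g y :: (x ++ a :: s))))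
      = 0 := by
    simp only [hdg, Pi.zero_apply, hf.map_zero, map_zero, smul_zero, splitSum_zero]
  rw [ht.mul_wordDiff hh (ht.mul_wordBVHomotopy hf)]
  simp only [wordDiff, wordComp_wordMul_right hf, wordComp_wordMul_right hg, wordCup,
    splitSum_append_cons, splitSum_add,
    wordId_append_cons, wordMul_append_cons_eq_ite, ite_mul, mul_ite, zero_mul, mul_zero,
    map_add, map_sub, map_splitSum, map_zsmul, smul_add, smul_sub, smul_splitSum, smul_smul,
    ← pow_add, List.append_assoc, List.cons_append, splitSum_sub, splitSum_assoc,
    splitSum_assoc_right, splitSum_assoc_right₂, splitSum_assoc_right₃,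
    hf.map_add, hf.map_sub, hf.map_zsmul, hf.map_splitSum, hf.map_ite, hf.map_ite₂, hf.map_add₂,
    apply_ite tr, map_zero, List.append_eq_nil_iff, reduceCtorEq, and_false, if_false,
    splitSum_zero, add_zero, zero_add,
    smul_ite, smul_zero, splitSum_ite_left, splitSum_ite_right, splitSum_ite_const,
    List.nil_append] at e1 e2 ⊢
  refine key _ _ _ _ _ _ _ _ _ _ _ _ _ _ _ _ _ _ _ _ _ _ _ _ e1 e2
    ?_ ?_ ?_ ?_ ?_ ?_ ?_ ?_ ?_ ?_ ?_ ?_ <;> clear e1 e2 key hdf hdg hh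
  · refine splitSum_congr fun u1 v1 h1 => ?_
    refine splitSum_congr fun u2 v2 h2 => ?_
    refine splitSum_congr fun u3 v3 h3 => ?_
    refine splitSum_congr fun u4 v4 h4 => ?_
    subst h4 h3 h2 h1
    rcases wordId_eq_zero_or u1 with h0 | h0
    · simp [h0, hf.map_zero, hf.map_zero₂]
    refine neg_one_pow_smul_congr ?_ _
    simp only [List.length_append, List.length_cons, List.length_nil, parity_simps, h0]
    grind
  · refine splitSum_eq_neg fun u1 v1 h1 => ?_
    refine splitSum_eq_neg fun u2 v2 h2 => ?_
    refine splitSum_eq_neg fun u3 v3 h3 => ?_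
    refine splitSum_eq_neg fun u4 v4 h4 => ?_
    refine splitSum_eq_neg fun u5 v5 h5 => ?_
    subst h5 h4 h3 h2 h1
    rcases hasWordParity_wordMul u5 with h0 | h0
    · simp [h0, hf.map_zero, hf.map_zero₂, hf.map_zero₃, hg.map_zero]
    refine neg_one_pow_smul_eq_neg ?_ _
    simp only [List.length_append, List.length_cons, List.length_nil, parity_simps] at h0 ⊢
    grind
  · refine splitSum_congr fun u1 v1 h1 => ?_
    refine splitSum_congr fun u2 v2 h2 => ?_
    refine splitSum_congr fun u3 v3 h3 => ?_
    refine splitSum_congr fun u4 v4 h4 => ?_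
    refine splitSum_congr fun u5 v5 h5 => ?_
    subst h5 h4 h3 h2 h1
    rcases hasWordParity_wordMul u4 with h0 | h0
    · simp [h0, hf.map_zero, hf.map_zero₂, hf.map_zero₃, hg.map_zero]
    refine neg_one_pow_smul_congr ?_ _
    simp only [List.length_append, List.length_cons, List.length_nil, parity_simps] at h0 ⊢
    grind
  · refine splitSum_eq_neg fun u1 v1 h1 => ?_
    refine splitSum_eq_neg fun u2 v2 h2 => ?_
    refine splitSum_eq_neg fun u3 v3 h3 => ?_
    refine splitSum_eq_neg fun u4 v4 h4 => ?_
    refine splitSum_eq_neg fun u5 v5 h5 => ?_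
    subst h5 h4 h3 h2 h1
    rcases hasWordParity_wordMul u3 with h0 | h0
    · simp [h0, hf.map_zero, hf.map_zero₂, hf.map_zero₃, hg.map_zero]
    refine neg_one_pow_smul_eq_neg ?_ _
    simp only [List.length_append, List.length_cons, List.length_nil, parity_simps] at h0 ⊢
    grind
  · refine splitSum_eq_neg fun u1 v1 h1 => ?_
    refine splitSum_eq_neg fun u2 v2 h2 => ?_
    refine splitSum_eq_neg fun u3 v3 h3 => ?_
    refine splitSum_eq_neg fun u4 v4 h4 => ?_
    refine splitSum_eq_neg fun u5 v5 h5 => ?_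
    subst h5 h4 h3 h2 h1
    rcases hasWordParity_wordMul u2 with h0 | h0
    · simp [h0, hf.map_zero, hf.map_zero₂, hf.map_zero₃, hg.map_zero]
    refine neg_one_pow_smul_eq_neg ?_ _
    simp only [List.length_append, List.length_cons, List.length_nil, parity_simps] at h0 ⊢
    grind
  · refine splitSum_congr fun u1 v1 h1 => ?_
    refine splitSum_congr fun u2 v2 h2 => ?_
    refine splitSum_congr fun u3 v3 h3 => ?_
    refine splitSum_congr fun u4 v4 h4 => ?_
    subst h4 h3 h2 h1
    rcases wordId_eq_zero_or v4 with h0 | h0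
    · simp [h0, hf.map_zero, hf.map_zero₂]
    refine neg_one_pow_smul_congr ?_ _
    simp only [List.length_append, List.length_cons, List.length_nil, parity_simps, h0]
    grind
  · refine splitSum_congr fun u1 v1 h1 => ?_
    refine splitSum_congr fun u2 v2 h2 => ?_
    subst h2 h1
    refine neg_one_pow_smul_congr ?_ _
    simp only [List.length_append, List.length_cons, List.length_nil, parity_simps]
    grind
  · refine splitSum_congr fun u1 v1 h1 => ?_
    refine splitSum_congr fun u2 v2 h2 => ?_
    subst h2 h1
    rw [ht.comm]
    refine neg_one_pow_smul_congr ?_ _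
    simp only [List.length_append, List.length_cons, List.length_nil, parity_simps]
    grind
  · refine splitSum_eq_neg fun u1 v1 h1 => ?_
    refine splitSum_eq_neg fun u2 v2 h2 => ?_
    subst h2 h1
    refine neg_one_pow_smul_eq_neg ?_ _
    simp only [List.length_append, List.length_cons, List.length_nil, parity_simps]
    grind
  · refine splitSum_eq_neg fun u1 v1 h1 => ?_
    refine splitSum_eq_neg fun u2 v2 h2 => ?_
    refine splitSum_eq_neg fun u3 v3 h3 => ?_
    refine splitSum_eq_neg fun u4 v4 h4 => ?_
    subst h4 h3 h2 h1
    rcases wordId_eq_zero_or u2 with h0 | h0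
    · simp [h0, hf.map_zero, hf.map_zero₂]
    rw [ht.comm]
    refine neg_one_pow_smul_eq_neg ?_ _
    simp only [List.length_append, List.length_cons, List.length_nil, parity_simps, h0]
    grind
  · refine splitSum_eq_neg fun u1 v1 h1 => ?_
    refine splitSum_eq_neg fun u2 v2 h2 => ?_
    refine splitSum_eq_neg fun u3 v3 h3 => ?_
    refine splitSum_eq_neg fun u4 v4 h4 => ?_
    subst h4 h3 h2 h1
    rcases wordId_eq_zero_or u3 with h0 | h0
    · simp [h0, hf.map_zero, hf.map_zero₂]
    refine neg_one_pow_smul_eq_neg ?_ _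
    simp only [List.length_append, List.length_cons, List.length_nil, parity_simps, h0]
    grind
  · refine splitSum_eq_neg fun u1 v1 h1 => ?_
    refine splitSum_eq_neg fun u2 v2 h2 => ?_
    refine splitSum_eq_neg fun u3 v3 h3 => ?_
    refine splitSum_eq_neg fun u4 v4 h4 => ?_
    subst h4 h3 h2 h1
    rcases wordId_eq_zero_or u4 with h0 | h0
    · simp [h0, hf.map_zero, hf.map_zero₂]
    refine neg_one_pow_smul_eq_neg ?_ _
    simp only [List.length_append, List.length_cons, List.length_nil, parity_simps, h0]
    grind

end IsSymmetrizingTrace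

end Trace

/-! ### Cyclic invariance, the square of the Connes operator, and the Batalin-Vilkovisky identity on
cocycles -/

section Trace

variable {k A M : Type*} [CommRing k] [Ring A] [Algebra k A] [AddCommGroup M] [Module k M]

namespace IsSymmetrizingTrace

variable {tr : A →ₗ[k] k} (ht : IsSymmetrizingTrace tr)
include ht

theorem wordMultilinear_wordBVHomotopy {f g : List A → A} (hf : WordMultilinear k f)
    (hg : WordMultilinear k g) : WordMultilinear k (wordBVHomotopy tr f g) := by
  have hf' := hf.comp_isLinearMap tr.isLinear
  have h (s t x y : List A) : IsLinearMap k fun a => tr (f (t ++ g y :: (x ++ a :: s))) := by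
    simpa only [List.append_assoc, List.cons_append] using hf' (t ++ g y :: x) s
  refine ht.wordMultilinear_traceRep (fun w => .splitSum w fun s r => .splitSum r fun t z =>
    .splitSum z fun y x => (h s t x y).zsmul _) fun a => .splitSum (fun r => ?_) fun s =>
    .splitSum (fun z => ?_) fun t => .splitSum (fun x => ?_) fun y => ?_
  · refine .splitSum_const r fun t z => .splitSum_const z fun y x => ?_
    convert (hf'.append_left (t ++ g y :: (x ++ [a]))).length_smul fun n => (-1 : ℤ) ^
      ((y.length + 1) * (n + t.length) + (n + 1) * (t.length + x.length + 1)) using 4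
    simp
  · exact .splitSum_const z fun y x => (hf'.append_right (g y :: (x ++ a :: s))).length_smul
      fun n => (-1 : ℤ) ^ ((y.length + 1) * (s.length + n) + (s.length + 1) * (n + x.length + 1))
  · exact (hf'.insert hg t (x ++ a :: s)).length_smul fun n => (-1 : ℤ) ^
      ((n + 1) * (s.length + t.length) + (s.length + 1) * (t.length + x.length + 1))
  · convert (hf'.append (t ++ [g y]) (a :: s)).length_smul fun n => (-1 : ℤ) ^
      ((y.length + 1) * (s.length + t.length) + (s.length + 1) * (t.length + n + 1)) using 4
    simp

theorem wordConnes_add {f g : List A → A} (hf : WordMultilinear k f) (hg : WordMultilinear k g) :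
    wordConnes tr (f + g) = wordConnes tr f + wordConnes tr g := by
  ext w
  refine ht.ext _ _ fun a => ?_
  simp only [ht.mul_wordConnes (hf.add hg), Pi.add_apply, mul_add, map_add, ht.mul_wordConnes hf,
    ht.mul_wordConnes hg, smul_add, splitSum_add]

theorem wordConnes_smul {f : List A → A} (hf : WordMultilinear k f) (c : k)
    (hcf : WordMultilinear k (c • f)) :
    wordConnes tr (c • f) = c • wordConnes tr f := by
  ext w
  refine ht.ext _ _ fun a => ?_
  simp only [ht.mul_wordConnes hcf, Pi.smul_apply, mul_smul_comm, map_smul, ht.mul_wordConnes hf,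
    smul_splitSum, smul_comm c]

theorem wordConnes_eq_zero {f : List A → A} (hf : WordMultilinear k f)
    (h : ∀ w, w ≠ [] → f w = 0) : wordConnes tr f = 0 := by
  ext w
  refine ht.ext _ _ fun a => ?_
  rw [ht.mul_wordConnes hf, Pi.zero_apply, mul_zero, map_zero]
  exact splitSum_eq_zero fun u v _ => by rw [h _ (by simp), map_zero, smul_zero]

theorem wordConnes_congr {f g : List A → A} (hf : WordMultilinear k f) (hg : WordMultilinear k g)
    {w : List A} (h : ∀ v, v.length = w.length + 1 → f v = g v) :
    wordConnes tr f w = wordConnes tr g w := by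
  refine ht.ext _ _ fun a => ?_
  rw [ht.mul_wordConnes hf, ht.mul_wordConnes hg]
  refine splitSum_congr fun u v huv => ?_
  rw [h]
  simp [← huv]
  omega

/-- Both sides sum over all rotations of one cyclic word; the sign is that of exchanging its two
arcs, which have lengths `x.length + 1` and `y.length + 1`. -/
theorem wordConnes_cyclic {f : List A → A} (hf : WordMultilinear k f) (x y : List A) (b c : A) :
    tr (c * wordConnes tr f (x ++ b :: y)) =
      (-1 : ℤ) ^ ((x.length + 1) * (y.length + 1)) • tr (b * wordConnes tr f (y ++ c :: x)) := by
  rw [ht.mul_wordConnes hf, ht.mul_wordConnes hf]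
  simp only [splitSum_append_cons, smul_add, smul_splitSum, smul_smul, ← pow_add,
    List.append_assoc, List.cons_append]
  rw [add_comm]
  refine congrArg₂ (· + ·) ?_ ?_ <;> refine splitSum_congr fun u v h => ?_ <;> subst h <;>
    refine neg_one_pow_smul_congr ?_ _ <;>
    simp only [List.length_append, List.length_cons, parity_simps] <;> grind

theorem wordConnes_wordConnes {f : List A → A} (hf : WordMultilinear k f) :
    wordConnes tr (wordConnes tr f) = -wordComp (wordConnes tr f) wordOne := by
  ext w
  refine ht.ext _ _ fun a => ?_
  rw [ht.mul_wordConnes (ht.wordMultilinear_wordConnes hf), Pi.neg_apply, mul_neg, map_neg,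
    wordComp, mul_splitSum, map_splitSum]
  refine splitSum_eq_neg fun u v huv => ?_
  rw [splitSum_eq_left (by simp +contextual [wordOne, (ht.wordMultilinear_wordConnes hf).map_zero])]
  -- Writing the outer factor as `1` and rotating until `a` is outside puts `1` among the arguments,
  -- between `u` and `v`.
  rw [← one_mul (wordConnes tr f (v ++ a :: u)), ht.wordConnes_cyclic hf, smul_smul, ← pow_add]
  simp only [wordOne, mul_smul_comm, map_zsmul]
  refine neg_one_pow_smul_eq_neg ?_ _
  simp only [List.length_nil, parity_simps]
  grind

/-- The two homotopies treat the two blocks in which the dual variable may lie. The product `Δg ⌣ f`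
appears in this order and is commuted only on cohomology. -/
theorem wordConnes_wordCup {f g : List A → A} {p q : ℕ} (hf : WordMultilinear k f)
    (hg : WordMultilinear k g) (hp : HasWordParity p f) (hq : HasWordParity q g)
    (hdf : wordDiff f = 0) (hdg : wordDiff g = 0) :
    wordConnes tr (wordCup f g) =
      wordCup (wordConnes tr f) g + (-1 : ℤ) ^ (p * q) • wordCup (wordConnes tr g) f
        - (-1 : ℤ) ^ (p * q + q) • wordComp f g - (-1 : ℤ) ^ p • wordComp g f +
        ((-1 : ℤ) ^ (p * q) • wordDiff (wordBVHomotopy tr f g) +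
          wordDiff (wordBVHomotopy tr g f)) := by
  have key : ∀ {f g : List A → A} {p q : ℕ}, WordMultilinear k f → WordMultilinear k g →
      HasWordParity p f → HasWordParity q g → wordDiff f = 0 → wordDiff g = 0 → ∀ a w,
      (splitSum w fun s z => splitSum z fun y x =>
        (-1 : ℤ) ^ ((s.length + 1) * (y.length + x.length)) • tr (g y * f (x ++ a :: s))) =
      tr (a * wordDiff (wordBVHomotopy tr f g) w) - (-1 : ℤ) ^ q • tr (a * wordComp f g w) +
        (-1 : ℤ) ^ (p * q) • tr (a * wordCup (wordConnes tr f) g w) := by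
    intro f g p q hf hg hp hq hdf hdg a w
    rw [ht.wordDiff_wordBVHomotopy hf hg hdf hdg (ht.wordMultilinear_wordBVHomotopy hf hg)]
    have e1 : (splitSum w fun s z => splitSum z fun y x =>
        (-1 : ℤ) ^ (y.length + (y.length + 1) * s.length) • tr (a * f (s ++ g y :: x))) =
        (-1 : ℤ) ^ q • tr (a * wordComp f g w) := by
      simp only [wordComp, mul_splitSum, map_splitSum, smul_splitSum, mul_smul_comm, map_zsmul,
        smul_smul, ← pow_add]
      refine splitSum_congr_all fun s z => splitSum_congr_all fun y x => ?_
      rcases hq y with h0 | h0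
      · simp [h0, hf.map_zero]
      refine neg_one_pow_smul_congr ?_ _
      simp only [parity_simps]
      grind
    have e2 : (splitSum w fun s r => splitSum r fun t y =>
        (-1 : ℤ) ^ (t.length + 1 + (y.length + 1) * (s.length + t.length + 1) +
          (s.length + 1) * (t.length + 1)) • tr (f (t ++ (g y * a) :: s))) =
        -((-1 : ℤ) ^ (p * q) • tr (a * wordCup (wordConnes tr f) g w)) := by
      have h (u v : List A) : tr (a * (wordConnes tr f u * g v)) =
          tr ((g v * a) * wordConnes tr f u) := by
        rw [← mul_assoc, ht.comm, mul_assoc]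
      simp only [wordCup, mul_splitSum, map_splitSum, h, ht.mul_wordConnes hf, splitSum_assoc,
        smul_splitSum, smul_smul, ← pow_add]
      refine splitSum_eq_neg fun s z _ => splitSum_eq_neg fun t y _ => ?_
      rcases hq y with h0 | h0
      · simp [h0, hf.map_zero]
      rcases hp (t ++ (g y * a) :: s) with h1 | h1
      · simp [h1]
      refine neg_one_pow_smul_eq_neg ?_ _
      simp only [List.length_append, List.length_cons, parity_simps] at h1 ⊢
      grind
    rw [e1, e2]
    abel
  ext w
  refine ht.ext _ _ fun a => ?_
  have h1 := key hf hg hp hq hdf hdg a w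
  have h2 := key hg hf hq hp hdg hdf a w
  -- The rotations are divided according to whether `a` is an argument of `f` or of `g`; in the
  -- first case the trace moves `g y` to the front, so both sums have the form treated in `key`.
  have h3 : tr (a * wordConnes tr (wordCup f g) w) = (-1 : ℤ) ^ (p * q) •
      (splitSum w fun s z => splitSum z fun y x =>
        (-1 : ℤ) ^ ((s.length + 1) * (y.length + x.length)) • tr (g y * f (x ++ a :: s))) +
      splitSum w fun s z => splitSum z fun y x =>
        (-1 : ℤ) ^ ((s.length + 1) * (y.length + x.length)) • tr (f y * g (x ++ a :: s)) := by
    rw [ht.mul_wordConnes (hf.cup hg)]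
    simp only [wordCup, splitSum_append_cons, map_add, map_splitSum, smul_add, smul_splitSum,
      splitSum_add, splitSum_assoc, splitSum_assoc_right, smul_smul, ← pow_add]
    rw [add_comm]
    refine congrArg₂ (· + ·) ?_ ?_
    · refine splitSum_congr fun s z hz => splitSum_congr fun y x hx => ?_
      rcases hq y with h0 | h0
      · simp [h0]
      rcases hp (x ++ a :: s) with h1 | h1
      · simp [h1]
      rw [ht.comm]
      refine neg_one_pow_smul_congr ?_ _
      simp only [List.length_append, List.length_cons, parity_simps] at h1 ⊢
      grind
    · refine splitSum_congr fun s z hz => splitSum_congr fun y x hx => ?_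
      refine neg_one_pow_smul_congr ?_ _
      simp only [← hx, List.length_append, List.length_cons, parity_simps]
      grind
  rw [h3, h1, h2]
  simp only [Pi.add_apply, Pi.sub_apply, Pi.smul_apply, mul_add, mul_sub, mul_smul_comm, map_add,
    map_sub, map_zsmul]
  rw [mul_comm q p]
  rcases neg_one_pow_eq_or ℤ p with h | h <;> rcases neg_one_pow_eq_or ℤ q with h' | h' <;>
    simp [pow_add, pow_mul, h, h'] <;> abel

end IsSymmetrizingTrace

end Trace

/-! ### Linearity, dependence of the differential on lengths, and insertion of the unit -/

section Words

variable {k A M : Type*} [CommRing k] [Ring A] [Algebra k A] [AddCommGroup M] [Module k M]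

theorem WordMultilinear.smul {F : List A → M} (c : k) (hF : WordMultilinear k F) :
    WordMultilinear k (c • F) := hF.comp_isLinearMap (LinearMap.lsmul k M c).isLinear

theorem wordCup_ksmul (c : k) (F G : List A → A) : wordCup F (c • G) = c • wordCup F G := by
  ext w; simp [wordCup, smul_splitSum]

theorem ksmul_wordCup (c : k) (F G : List A → A) : wordCup (c • F) G = c • wordCup F G := by
  ext w; simp [wordCup, smul_splitSum]

theorem wordComp_ksmul {F : List A → M} (hF : WordMultilinear k F) (c : k) (f : List A → A) :
    wordComp F (c • f) = c • wordComp F f := by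
  ext w; simp only [wordComp, Pi.smul_apply, (hF _ _).map_smul, smul_splitSum, smul_comm c]

theorem ksmul_wordComp (c : k) (F f : List A → A) :
    wordComp (c • F) f = c • wordComp F f := by
  ext w; simp only [wordComp, Pi.smul_apply, smul_splitSum, smul_comm c]

theorem wordBracket_add {F : List A → A} {p q : ℕ} (hF : WordMultilinear k F) (G H : List A → A) :
    wordBracket p q F (G + H) = wordBracket p q F G + wordBracket p q F H := by
  simp only [wordBracket, wordComp_add hF, add_wordComp, smul_add]
  abel

theorem add_wordBracket {H : List A → A} {p q : ℕ} (hH : WordMultilinear k H) (F G : List A → A) :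
    wordBracket p q (F + G) H = wordBracket p q F H + wordBracket p q G H := by
  simp only [wordBracket, wordComp_add hH, add_wordComp, smul_add]
  abel

theorem wordBracket_ksmul {F : List A → A} {p q : ℕ} (hF : WordMultilinear k F) (c : k)
    (G : List A → A) : wordBracket p q F (c • G) = c • wordBracket p q F G := by
  simp only [wordBracket, wordComp_ksmul hF, ksmul_wordComp, smul_sub, smul_comm c]

theorem ksmul_wordBracket {G : List A → A} {p q : ℕ} (hG : WordMultilinear k G) (c : k)
    (F : List A → A) : wordBracket p q (c • F) G = c • wordBracket p q F G := by
  simp only [wordBracket, wordComp_ksmul hG, ksmul_wordComp, smul_sub, smul_comm c]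

theorem wordBracket_congr {p q p' q' : ℕ} (hp : Even p ↔ Even p') (hq : Even q ↔ Even q')
    (F G : List A → A) : wordBracket p q F G = wordBracket p' q' F G := by
  rw [wordBracket, wordBracket, neg_one_pow_smul_congr]
  simp only [parity_simps, hp, hq]

theorem wordBracket_skew (p q : ℕ) (F G : List A → A) :
    wordBracket p q F G = -((-1 : ℤ) ^ ((p + 1) * (q + 1)) • wordBracket q p G F) := by
  rw [wordBracket, wordBracket, mul_comm (q + 1), smul_sub, smul_smul, ← pow_add,
    Even.neg_one_pow ⟨_, rfl⟩]
  simp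

theorem wordBracket_self {p : ℕ} (hp : Odd p) (F : List A → A) : wordBracket p p F F = 0 := by
  rw [wordBracket, Even.neg_one_pow, one_smul, sub_self]
  simp only [parity_simps]
  simpa using hp

theorem WordMultilinear.bracket {F G : List A → A} (hF : WordMultilinear k F)
    (hG : WordMultilinear k G) (p q : ℕ) : WordMultilinear k (wordBracket p q F G) :=
  ((hF.comp hG).zsmul _).sub (hG.comp hF)

theorem wordDiff_add {F G : List A → A} : wordDiff (F + G) = wordDiff F + wordDiff G := by
  ext w
  simp only [wordDiff, wordCup_add, add_wordComp, Pi.add_apply, add_mul, smul_add, splitSum_add]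
  abel

theorem wordDiff_ksmul (c : k) (F : List A → A) : wordDiff (c • F) = c • wordDiff F := by
  ext w
  simp only [wordDiff, wordCup_ksmul, ksmul_wordComp, Pi.smul_apply, smul_add, smul_sub,
    smul_mul_assoc, smul_splitSum, smul_comm c]

theorem wordDiff_smul (c : ℤ) (F : List A → A) : wordDiff (c • F) = c • wordDiff F := by
  rw [← Int.cast_smul_eq_zsmul ℤ, ← Int.cast_smul_eq_zsmul ℤ]
  exact wordDiff_ksmul _ F

theorem wordDiff_zero : wordDiff (0 : List A → A) = 0 := by
  simpa using wordDiff_ksmul (0 : ℤ) (0 : List A → A)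

theorem WordMultilinear.diff {F : List A → A} (hF : WordMultilinear k F) :
    WordMultilinear k (wordDiff F) := by
  refine ((wordMultilinear_wordId.cup hF).sub (hF.comp wordMultilinear_wordMul)).add
    (.splitSum (fun v => ?_) fun u => ?_)
  · exact (hF.comp_isLinearMap (L := fun a => a * wordId v)
      ⟨fun _ _ => add_mul _ _ _, fun _ _ => smul_mul_assoc _ _ _⟩).length_smul
        fun n => (-1 : ℤ) ^ (n + 1)
  · exact (wordMultilinear_wordId.comp_isLinearMap (L := fun a => F u * a)
      ⟨fun _ _ => mul_add _ _ _, fun _ _ => mul_smul_comm _ _ _⟩).zsmul _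

theorem wordMul_eq_zero_or (w : List A) : wordMul w = 0 ∨ w.length = 2 := by
  rcases w with _ | ⟨a, _ | ⟨b, _ | ⟨c, w⟩⟩⟩ <;> simp [wordMul]

/-- The differential is homogeneous of degree one even for functions not supported in one length:
terms with other lengths contain a value `0` of `wordId` or `wordMul`, and multilinearity kills an
inserted `0`. -/
theorem wordDiff_congr {F G : List A → A} (hF : WordMultilinear k F) (hG : WordMultilinear k G)
    {w : List A} (h : ∀ v, v.length + 1 = w.length → F v = G v) :
    wordDiff F w = wordDiff G w := by
  have h1 : wordCup wordId F w = wordCup wordId G w := by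
    refine splitSum_congr fun u v huv => ?_
    rcases wordId_eq_zero_or u with h0 | h0
    · simp [h0]
    · rw [h v (by simp [← huv, h0]; omega)]
  have h2 : wordComp F wordMul w = wordComp G wordMul w := by
    refine splitSum_congr fun u x hux => splitSum_congr fun v z hvz => ?_
    rcases wordMul_eq_zero_or v with h0 | h0
    · simp [h0, hF.map_zero, hG.map_zero]
    · rw [h (u ++ wordMul v :: z) (by simp [← hux, ← hvz, h0]; omega)]
  rw [wordDiff, wordDiff, h1, h2]
  congr 1
  refine splitSum_congr fun u v huv => ?_
  rcases wordId_eq_zero_or v with h0 | h0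
  · simp [h0]
  · rw [h u (by simp [← huv, h0])]

theorem wordDiff_nil {F : List A → A} (hF : WordMultilinear k F) : wordDiff F [] = 0 := by
  have h : F [0] = 0 := hF.map_zero [] []
  simp [h, wordDiff, wordCup, wordComp, wordId, wordMul, splitSum_nil]

/-- The cup commutators from the two orders of insertion cancel in the bracket. -/
theorem wordDiff_wordBracket {F G : List A → A} {p q : ℕ} (hF : HasWordParity p F)
    (hF' : WordMultilinear k F) (hG : HasWordParity q G) (hG' : WordMultilinear k G) :
    wordDiff (wordBracket p q F G) = wordBracket (p + 1) q (wordDiff F) G +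
      (-1 : ℤ) ^ (p + 1) • wordBracket p (q + 1) F (wordDiff G) := by
  have h1 := wordDiff_wordComp hF hF' hG
  have h2 := wordDiff_wordComp hG hG' hF
  simp only [wordBracket, sub_eq_add_neg, ← neg_one_zsmul (wordComp _ _), wordDiff_add,
    wordDiff_smul, h1, h2]
  rcases neg_one_pow_eq_or ℤ p with h | h <;> rcases neg_one_pow_eq_or ℤ q with h' | h' <;>
    simp [pow_add, pow_mul, h, h'] <;> abel

theorem hasWordParity_wordOne : HasWordParity 0 (wordOne : List A → A) := by
  rw [← wordOf_one (k := ℤ)]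
  exact hasWordParity_wordOf _

theorem wordMultilinear_wordOne : WordMultilinear k (wordOne : List A → A) := by
  rw [← wordOf_one (k := k)]
  exact wordMultilinear_wordOf _

theorem wordOne_wordComp (F : List A → A) : wordComp wordOne F = 0 := by
  ext w
  refine splitSum_eq_zero fun u x _ => splitSum_eq_zero fun v z _ => ?_
  rcases u with _ | ⟨a, u⟩ <;> simp [wordOne]

theorem wordDiff_wordOne : wordDiff (wordOne : List A → A) = 0 := by
  rw [wordDiff_eq hasWordParity_wordOne, wordOne_wordComp, wordCup_wordOne, wordOne_wordCup]
  simp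

/-- The composition of a cocycle with the unit is a coboundary. -/
theorem exists_wordComp_wordOne {F : List A → A} {p : ℕ} (hF : HasWordParity p F)
    (hF' : WordMultilinear k F) (dF : wordDiff F = 0) :
    ∃ G, WordMultilinear k G ∧ wordComp F wordOne = wordDiff G := by
  have h1 : WordMultilinear k (wordOne : List A → A) := wordMultilinear_wordOne
  have h2 := hasWordParity_wordOne (A := A)
  -- The Leibniz rule for `1 ⌣ 1` gives `{F, 1} = {F, 1} + {F, 1}` up to a coboundary, because
  -- nothing can be inserted into `1` and the sign is trivial in degree 0.
  have h := wordDiff_wordBrace hF hF' h2 h1 h2 h1 (hF.brace hF' h2 h2) dF wordDiff_wordOne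
    wordDiff_wordOne
  have hB := hF'.brace h1 h1
  rw [wordCup_wordOne, wordCup_wordOne, wordOne_wordCup] at h
  simp only [wordBracket, wordOne_wordComp] at h
  refine ⟨_, hB.zsmul (-1), ?_⟩
  rw [wordDiff_smul]
  rcases neg_one_pow_eq_or ℤ p with h' | h' <;> simp [pow_add, h'] at h ⊢
  · linear_combination (norm := abel1) h
  · linear_combination (norm := abel1) -h

end Words

/-! ### The operations on Hochschild cohomology -/

section Cohomology

open HochschildCochain

variable {k A : Type*} [CommRing k] [Ring A] [Algebra k A]

/-- The part of a function of words on words of length `n`. -/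
def wordTrunc (n : ℕ) : (List A → A) →ₗ[k] (List A → A) where
  toFun F w := if w.length = n then F w else 0
  map_add' F G := by ext w; by_cases h : w.length = n <;> simp [h]
  map_smul' c F := by ext w; by_cases h : w.length = n <;> simp [h]

theorem wordTrunc_apply (n : ℕ) (F : List A → A) (w : List A) :
    wordTrunc (k := k) n F w = if w.length = n then F w else 0 := rfl

theorem WordMultilinear.trunc {F : List A → A} (hF : WordMultilinear k F) (n : ℕ) :
    WordMultilinear k (wordTrunc (k := k) n F) := by
  convert hF.length_smul fun m => if m = n then 1 else 0 using 2 with w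
  by_cases h : w.length = n <;> simp [wordTrunc_apply, h]

/-- Truncation passes through the differential with a shift, so the primitive of a homogeneous
function may be taken homogeneous. -/
theorem wordTrunc_succ_wordDiff {F : List A → A} (hF : WordMultilinear k F) (n : ℕ) :
    wordTrunc (k := k) (n + 1) (wordDiff F) = wordDiff (wordTrunc (k := k) n F) := by
  ext w
  rw [wordTrunc_apply]
  split_ifs with h
  · refine wordDiff_congr hF (hF.trunc n) fun v hv => ?_
    rw [wordTrunc_apply, if_pos (by omega)]
  · rw [wordDiff_congr (hF.trunc n) (G := 0) .zero fun v hv => ?_, wordDiff_zero, Pi.zero_apply]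
    rw [wordTrunc_apply, if_neg (by omega), Pi.zero_apply]

theorem wordTrunc_zero_wordDiff {F : List A → A} (hF : WordMultilinear k F) :
    wordTrunc (k := k) 0 (wordDiff F) = 0 := by
  ext w
  rcases w with _ | ⟨a, w⟩ <;> simp [wordTrunc_apply, wordDiff_nil hF]

variable (k A) in
/-- The functions of words which are coboundaries of multilinear functions of words. -/
def wordExact : Submodule k (List A → A) where
  carrier := {G | ∃ F, WordMultilinear k F ∧ G = wordDiff F}
  add_mem' := by
    rintro _ _ ⟨F, hF, rfl⟩ ⟨G, hG, rfl⟩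
    exact ⟨F + G, hF.add hG, wordDiff_add.symm⟩
  zero_mem' := ⟨0, .zero, wordDiff_zero.symm⟩
  smul_mem' := by
    rintro c _ ⟨F, hF, rfl⟩
    exact ⟨c • F, hF.smul c, (wordDiff_ksmul c F).symm⟩

theorem wordTrunc_mem_wordExact (n : ℕ) {G : List A → A} (h : G ∈ wordExact k A) :
    wordTrunc (k := k) n G ∈ wordExact k A := by
  obtain ⟨F, hF, rfl⟩ := h
  rcases n with _ | n
  · rw [wordTrunc_zero_wordDiff hF]
    exact zero_mem _
  · exact ⟨_, hF.trunc n, wordTrunc_succ_wordDiff hF n⟩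

theorem wordTrunc_wordOf {n : ℕ} (m : ℕ) (f : HochschildCochain k A n) :
    wordTrunc (k := k) m (wordOf f) = if m = n then wordOf f else 0 := by
  ext w
  rw [wordTrunc_apply]
  split_ifs with h1 h2 h2
  · rfl
  · rw [wordOf_of_ne _ (by omega)]; rfl
  · rw [wordOf_of_ne _ (by omega)]
  · rfl

theorem mem_cocycles_iff {n : ℕ} {f : HochschildCochain k A n} :
    f ∈ cocycles k A n ↔ wordDiff (wordOf f) = 0 := by
  rw [LinearMap.mem_ker, ← wordOf_injective.eq_iff, wordOf_differential, wordOf_zero]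

/-- Allowing inhomogeneous primitives creates no new coboundaries: only the part in length `n - 1`
matters, and in degree 0 the differential vanishes on the empty word. -/
theorem mem_coboundaries_iff {n : ℕ} {f : HochschildCochain k A n} :
    f ∈ coboundaries k A n ↔ wordOf f ∈ wordExact k A := by
  constructor
  · intro h
    rcases n with _ | n
    · obtain rfl : f = 0 := h
      rw [wordOf_zero]
      exact zero_mem _
    · obtain ⟨g, rfl⟩ := h
      exact ⟨wordOf g, wordMultilinear_wordOf g, wordOf_differential g⟩
  · rintro ⟨F, hF, h⟩
    rcases n with _ | n
    · refine eq_of_wordOf fun w hw => ?_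
      rw [List.length_eq_zero_iff.1 hw, h, wordDiff_nil hF, wordOf_zero, Pi.zero_apply]
    · refine ⟨cochainOf hF n, eq_of_wordOf fun w hw => ?_⟩
      rw [wordOf_differential, h]
      exact wordDiff_congr (wordMultilinear_wordOf _) hF fun v hv =>
        wordOf_cochainOf hF (by omega)

theorem exists_of_mem_coboundaries {n : ℕ} {f : HochschildCochain k A n}
    (h : f ∈ coboundaries k A n) :
    ∃ F, WordMultilinear k F ∧ HasWordParity (n + 1) F ∧ wordOf f = wordDiff F := by
  rcases n with _ | n
  · obtain rfl : f = 0 := h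
    exact ⟨0, .zero, fun w => .inl rfl, by rw [wordOf_zero, wordDiff_zero]⟩
  · obtain ⟨g, rfl⟩ := h
    refine ⟨wordOf g, wordMultilinear_wordOf g, fun w => ?_, wordOf_differential g⟩
    simpa only [parity_simps, not_not] using hasWordParity_wordOf g w

variable (k A) in
/-- The word function of a cocycle, as a linear map. -/
def cocycleWord (n : ℕ) : cocycles k A n →ₗ[k] (List A → A) where
  toFun f := wordOf f.1
  map_add' f g := wordOf_add f.1 g.1
  map_smul' c f := wordOf_smul c f.1

variable (k A) in
/-- The map from the cohomology in degree `n` to functions of words modulo coboundaries. -/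
noncomputable def cohomologyWord (n : ℕ) :
    HochschildCohomology k A n →ₗ[k] (List A → A) ⧸ wordExact k A :=
  Submodule.liftQ _ ((wordExact k A).mkQ ∘ₗ cocycleWord k A n) fun f hf => by
    rw [LinearMap.mem_ker, LinearMap.comp_apply, Submodule.mkQ_apply,
      Submodule.Quotient.mk_eq_zero]
    exact mem_coboundaries_iff.1 hf

variable (k A) in
/-- The map from the total cohomology to functions of words modulo coboundaries. -/
noncomputable def totalCohomologyWord :
    (⨁ n, HochschildCohomology k A n) →ₗ[k] (List A → A) ⧸ wordExact k A :=
  DirectSum.toModule k ℕ _ (cohomologyWord k A)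

theorem totalCohomologyWord_cls {n : ℕ} (f : HochschildCochain k A n)
    (hf : f ∈ cocycles k A n) :
    totalCohomologyWord k A (HochschildCohomology.cls f hf) =
      Submodule.Quotient.mk (wordOf f) := by
  rw [totalCohomologyWord, HochschildCohomology.cls, DirectSum.toModule_lof]
  rfl

theorem cohomologyWord_injective (n : ℕ) : Function.Injective (cohomologyWord k A n) := by
  rw [injective_iff_map_eq_zero]
  intro x hx
  obtain ⟨f, rfl⟩ := Submodule.Quotient.mk_surjective _ x
  rw [Submodule.Quotient.mk_eq_zero]
  exact mem_coboundaries_iff.2 ((Submodule.Quotient.mk_eq_zero _).1 hx)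

variable (k A) in
/-- The truncation of functions of words, modulo coboundaries. -/
noncomputable def quotientTrunc (n : ℕ) :
    ((List A → A) ⧸ wordExact k A) →ₗ[k] (List A → A) ⧸ wordExact k A :=
  (wordExact k A).mapQ (wordExact k A) (wordTrunc n) fun _ => wordTrunc_mem_wordExact n

/-- Truncation descends to classes and recovers each homogeneous component, so different degrees
cannot cancel in the quotient. -/
theorem quotientTrunc_totalCohomologyWord (n : ℕ) (x : ⨁ n, HochschildCohomology k A n) :
    quotientTrunc k A n (totalCohomologyWord k A x) = cohomologyWord k A n (x n) := by
  induction x using DirectSum.induction_on with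
  | zero => simp
  | add x y hx hy => simp [hx, hy]
  | of m x =>
    obtain ⟨f, rfl⟩ := Submodule.Quotient.mk_surjective _ x
    have h := totalCohomologyWord_cls f.1 f.2
    rw [HochschildCohomology.cls, DirectSum.lof_eq_of] at h
    rw [h]
    have h' : quotientTrunc k A n (Submodule.Quotient.mk (wordOf f.1)) =
      Submodule.Quotient.mk (wordTrunc (k := k) n (wordOf f.1)) := rfl
    rw [h', wordTrunc_wordOf]
    split_ifs with hn
    · subst hn
      rw [DirectSum.of_eq_same]
      rfl
    · rw [DirectSum.of_eq_of_ne _ _ _ hn, map_zero, Submodule.Quotient.mk_zero]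

theorem totalCohomologyWord_injective : Function.Injective (totalCohomologyWord k A) := by
  intro x y h
  ext1 n
  apply cohomologyWord_injective n
  rw [← quotientTrunc_totalCohomologyWord, h, quotientTrunc_totalCohomologyWord]

variable (k A) in
/-- The class of a cocycle in the total cohomology, as a linear map. -/
noncomputable def classMap (n : ℕ) : cocycles k A n →ₗ[k] ⨁ n, HochschildCohomology k A n :=
  DirectSum.lof k ℕ (HochschildCohomology k A) n ∘ₗ Submodule.mkQ _

theorem classMap_eq {n : ℕ} (f : cocycles k A n) :
    classMap k A n f = HochschildCohomology.cls f.1 f.2 := rfl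

theorem classMap_eq_zero {n : ℕ} {f : cocycles k A n} (h : wordOf f.1 ∈ wordExact k A) :
    classMap k A n f = 0 := by
  apply totalCohomologyWord_injective
  rw [classMap_eq, totalCohomologyWord_cls, map_zero, Submodule.Quotient.mk_eq_zero]
  exact h

/-- A function of words which represents an element of the total cohomology of the parity `p`. -/
def Represents (p : ℕ) (x : ⨁ n, HochschildCohomology k A n) (F : List A → A) : Prop :=
  (x = 0 ∧ F = 0) ∨ ∃ (n : ℕ) (f : HochschildCochain k A n) (hf : f ∈ cocycles k A n),
    x = HochschildCohomology.cls f hf ∧ F = wordOf f ∧ (Even n ↔ Even p)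

namespace Represents

variable {p : ℕ} {x : ⨁ n, HochschildCohomology k A n} {F : List A → A}

theorem multilinear (h : Represents p x F) : WordMultilinear k F := by
  rcases h with ⟨-, rfl⟩ | ⟨n, f, hf, -, rfl, -⟩
  · exact .zero
  · exact wordMultilinear_wordOf f

theorem parity (h : Represents p x F) : HasWordParity p F := by
  rcases h with ⟨-, rfl⟩ | ⟨n, f, hf, -, rfl, hn⟩
  · exact fun w => .inl rfl
  · intro w
    rw [← hn]
    exact hasWordParity_wordOf f w

theorem diff_eq_zero (h : Represents p x F) : wordDiff F = 0 := by
  rcases h with ⟨-, rfl⟩ | ⟨n, f, hf, -, rfl, hn⟩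
  · exact wordDiff_zero
  · exact mem_cocycles_iff.1 hf

theorem total_eq (h : Represents p x F) :
    totalCohomologyWord k A x = Submodule.Quotient.mk F := by
  rcases h with ⟨rfl, rfl⟩ | ⟨n, f, hf, rfl, rfl, hn⟩
  · rw [map_zero, Submodule.Quotient.mk_zero]
  · exact totalCohomologyWord_cls f hf

end Represents

theorem exists_represents (n : ℕ) (x : HochschildCohomology k A n) :
    ∃ F, Represents n (DirectSum.lof k ℕ (HochschildCohomology k A) n x) F := by
  obtain ⟨f, rfl⟩ := Submodule.Quotient.mk_surjective _ x
  exact ⟨wordOf f.1, .inr ⟨n, f.1, f.2, rfl, rfl, Iff.rfl⟩⟩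

end Cohomology

/-! ### Cup product and bracket on total cohomology -/

section Cohomology

open HochschildCochain

variable {k A : Type*} [CommRing k] [Ring A] [Algebra k A]

/-- The usual additive group of a direct sum, recorded to help instance search. -/
abbrev directSumAddCommGroup (V : ℕ → Type*) [∀ p, AddCommGroup (V p)] :
    AddCommGroup (⨁ p, V p) := inferInstance

noncomputable instance HochschildCohomology.instAddCommGroupTotal :
    AddCommGroup (⨁ n, HochschildCohomology k A n) :=
  directSumAddCommGroup (HochschildCohomology k A)

section Extension

variable {T : Type*} [AddCommGroup T] [Module k T]

/-- A bilinear map which vanishes on two submodules, as a map of the quotients. -/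
def quotientLift₂ {M N : Type*} [AddCommGroup M] [Module k M] [AddCommGroup N] [Module k N]
    {M' : Submodule k M} {N' : Submodule k N} (φ : M →ₗ[k] N →ₗ[k] T)
    (hl : ∀ x ∈ M', φ x = 0) (hr : ∀ x, ∀ y ∈ N', φ x y = 0) : (M ⧸ M') →ₗ[k] (N ⧸ N') →ₗ[k] T :=
  (N'.liftQ (M'.liftQ φ hl).flip fun y hy => by
    rw [LinearMap.mem_ker]
    ext x
    exact hr x y hy).flip

/-- A family of bilinear maps of cocycles which vanish on coboundaries, as a bilinear map of the
total cohomology. -/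
noncomputable def bilinearExtension (φ : ∀ p q, cocycles k A p →ₗ[k] cocycles k A q →ₗ[k] T)
    (hl : ∀ p q (f : cocycles k A p) g, f.1 ∈ coboundaries k A p → φ p q f g = 0)
    (hr : ∀ p q f (g : cocycles k A q), g.1 ∈ coboundaries k A q → φ p q f g = 0) :
    (⨁ n, HochschildCohomology k A n) →ₗ[k] (⨁ n, HochschildCohomology k A n) →ₗ[k] T :=
  DirectSum.toModule k ℕ _ fun p => (DirectSum.toModule k ℕ _ fun q =>
    (quotientLift₂ (φ p q) (fun x hx => LinearMap.ext fun y => hl p q x y hx)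
      (fun x y hy => hr p q x y hy)).flip).flip

theorem bilinearExtension_cls (φ : ∀ p q, cocycles k A p →ₗ[k] cocycles k A q →ₗ[k] T)
    (hl : ∀ p q (f : cocycles k A p) g, f.1 ∈ coboundaries k A p → φ p q f g = 0)
    (hr : ∀ p q f (g : cocycles k A q), g.1 ∈ coboundaries k A q → φ p q f g = 0)
    {p q : ℕ} (f : HochschildCochain k A p) (hf : f ∈ cocycles k A p)
    (g : HochschildCochain k A q) (hg : g ∈ cocycles k A q) :
    bilinearExtension φ hl hr (HochschildCohomology.cls f hf) (HochschildCohomology.cls g hg) =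
      φ p q ⟨f, hf⟩ ⟨g, hg⟩ := by
  rw [bilinearExtension, HochschildCohomology.cls, HochschildCohomology.cls,
    DirectSum.toModule_lof, LinearMap.flip_apply, DirectSum.toModule_lof]
  rfl

end Extension

theorem cup_mem_cocycles {p q n : ℕ} (h : p + q = n) {f : HochschildCochain k A p}
    (hf : f ∈ cocycles k A p) {g : HochschildCochain k A q} (hg : g ∈ cocycles k A q) :
    cup h f g ∈ cocycles k A n := by
  rw [mem_cocycles_iff] at *
  rw [wordOf_cup, wordDiff_wordCup (hasWordParity_wordOf f) (hasWordParity_wordOf g)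
    (wordMultilinear_wordOf g), hf, hg, zero_wordCup, wordCup_zero, smul_zero, add_zero]

theorem wordBracket_zero {p q : ℕ} {F : List A → A} (hF : WordMultilinear k F) :
    wordBracket p q F 0 = 0 := by
  simpa using wordBracket_ksmul (p := p) (q := q) hF 0 0

theorem zero_wordBracket {p q : ℕ} {F : List A → A} (hF : WordMultilinear k F) :
    wordBracket p q 0 F = 0 := by
  simpa using ksmul_wordBracket (p := p) (q := q) hF 0 0

theorem bracket_mem_cocycles {p q n : ℕ} (h : p + q = n + 1) {f : HochschildCochain k A p}
    (hf : f ∈ cocycles k A p) {g : HochschildCochain k A q} (hg : g ∈ cocycles k A q) :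
    bracket h f g ∈ cocycles k A n := by
  rw [mem_cocycles_iff] at *
  rw [wordOf_bracket, wordDiff_wordBracket (hasWordParity_wordOf f) (wordMultilinear_wordOf f)
    (hasWordParity_wordOf g) (wordMultilinear_wordOf g), hf, hg,
    zero_wordBracket (wordMultilinear_wordOf g), wordBracket_zero (wordMultilinear_wordOf f),
    smul_zero, add_zero]

variable (k A) in
/-- The cup product of cocycles. -/
noncomputable def cocycleCup (p q : ℕ) :
    cocycles k A p →ₗ[k] cocycles k A q →ₗ[k] cocycles k A (p + q) :=
  LinearMap.mk₂ k (fun f g => ⟨cup rfl f.1 g.1, cup_mem_cocycles rfl f.2 g.2⟩)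
    (fun f f' g => Subtype.ext <| wordOf_injective <| by
      simp [wordOf_cup, wordOf_add, add_wordCup])
    (fun c f g => Subtype.ext <| wordOf_injective <| by
      simp [wordOf_cup, wordOf_smul, ksmul_wordCup])
    (fun f g g' => Subtype.ext <| wordOf_injective <| by
      simp [wordOf_cup, wordOf_add, wordCup_add])
    (fun c f g => Subtype.ext <| wordOf_injective <| by
      simp [wordOf_cup, wordOf_smul, wordCup_ksmul])

/-- The bracket of cocycles. -/
noncomputable def cocycleBracket {p q n : ℕ} (h : p + q = n + 1) :
    cocycles k A p →ₗ[k] cocycles k A q →ₗ[k] cocycles k A n :=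
  LinearMap.mk₂ k (fun f g => ⟨bracket h f.1 g.1, bracket_mem_cocycles h f.2 g.2⟩)
    (fun f f' g => Subtype.ext <| wordOf_injective <| by
      simp [wordOf_bracket, wordOf_add, add_wordBracket (wordMultilinear_wordOf g.1)])
    (fun c f g => Subtype.ext <| wordOf_injective <| by
      simp [wordOf_bracket, wordOf_smul, ksmul_wordBracket (wordMultilinear_wordOf g.1)])
    (fun f g g' => Subtype.ext <| wordOf_injective <| by
      simp [wordOf_bracket, wordOf_add, wordBracket_add (wordMultilinear_wordOf f.1)])
    (fun c f g => Subtype.ext <| wordOf_injective <| by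
      simp [wordOf_bracket, wordOf_smul, wordBracket_ksmul (wordMultilinear_wordOf f.1)])

variable (k A) in
/-- The bracket of cocycles, as a class in the total cohomology. -/
noncomputable def cocycleBracketClass (p q : ℕ) :
    cocycles k A p →ₗ[k] cocycles k A q →ₗ[k] ⨁ n, HochschildCohomology k A n :=
  -- With truncated subtraction the condition fails exactly for `p = q = 0`, where the bracket would
  -- have degree `-1`.
  if h : p + q = (p + q - 1) + 1 then (cocycleBracket h).compr₂ (classMap k A _) else 0

theorem cocycleBracketClass_eq {p q n : ℕ} (h : p + q = n + 1) :
    cocycleBracketClass k A p q = (cocycleBracket h).compr₂ (classMap k A n) := by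
  obtain rfl : n = p + q - 1 := by omega
  exact dif_pos h

variable (k A) in
/-- The cup product on the total cohomology. -/
noncomputable def cohomologyCup : (⨁ n, HochschildCohomology k A n) →ₗ[k]
    (⨁ n, HochschildCohomology k A n) →ₗ[k] ⨁ n, HochschildCohomology k A n :=
  bilinearExtension (fun p q => (cocycleCup k A p q).compr₂ (classMap k A (p + q)))
    (fun p q f g h => classMap_eq_zero (by
      obtain ⟨F, hF, hF', e⟩ := exists_of_mem_coboundaries h
      refine ⟨wordCup F (wordOf g.1), hF.cup (wordMultilinear_wordOf _), ?_⟩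
      rw [wordDiff_wordCup hF' (hasWordParity_wordOf _) (wordMultilinear_wordOf g.1), ← e,
        mem_cocycles_iff.1 g.2, wordCup_zero, smul_zero, add_zero]
      exact wordOf_cup rfl _ _))
    (fun p q f g h => classMap_eq_zero (by
      obtain ⟨G, hG, hG', e⟩ := exists_of_mem_coboundaries h
      refine ⟨(-1 : ℤ) ^ p • wordCup (wordOf f.1) G,
        ((wordMultilinear_wordOf _).cup hG).zsmul _, ?_⟩
      rw [wordDiff_smul, wordDiff_wordCup (hasWordParity_wordOf _) hG' hG, ← e,
        mem_cocycles_iff.1 f.2, zero_wordCup, zero_add, smul_smul, ← pow_add,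
        Even.neg_one_pow ⟨p, rfl⟩, one_smul]
      exact wordOf_cup rfl _ _))

variable (k A) in
/-- The Gerstenhaber bracket on the total cohomology. -/
noncomputable def cohomologyBracket : (⨁ n, HochschildCohomology k A n) →ₗ[k]
    (⨁ n, HochschildCohomology k A n) →ₗ[k] ⨁ n, HochschildCohomology k A n :=
  bilinearExtension (cocycleBracketClass k A)
    (fun p q f g h => by
      by_cases hn : p + q = (p + q - 1) + 1
      · rw [cocycleBracketClass_eq hn]
        refine classMap_eq_zero ?_
        obtain ⟨F, hF, hF', e⟩ := exists_of_mem_coboundaries h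
        have hg := wordMultilinear_wordOf g.1
        refine ⟨wordBracket (p + 1) q F (wordOf g.1), hF.bracket hg _ _, ?_⟩
        rw [wordDiff_wordBracket hF' hF (hasWordParity_wordOf _) hg, ← e,
          mem_cocycles_iff.1 g.2, wordBracket_zero hF, smul_zero, add_zero,
          wordBracket_congr (p' := p) (q' := q) (by simp only [parity_simps, not_not]) Iff.rfl]
        exact wordOf_bracket hn _ _
      · rw [cocycleBracketClass, dif_neg hn]
        rfl)
    (fun p q f g h => by
      by_cases hn : p + q = (p + q - 1) + 1
      · rw [cocycleBracketClass_eq hn]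
        refine classMap_eq_zero ?_
        obtain ⟨G, hG, hG', e⟩ := exists_of_mem_coboundaries h
        have hf := wordMultilinear_wordOf f.1
        refine ⟨(-1 : ℤ) ^ (p + 1) • wordBracket p (q + 1) (wordOf f.1) G,
          (hf.bracket hG _ _).zsmul _, ?_⟩
        rw [wordDiff_smul, wordDiff_wordBracket (hasWordParity_wordOf _) hf hG' hG, ← e,
          mem_cocycles_iff.1 f.2, zero_wordBracket hG, zero_add, smul_smul, ← pow_add,
          Even.neg_one_pow ⟨p + 1, rfl⟩, one_smul,
          wordBracket_congr (p' := p) (q' := q) Iff.rfl (by simp only [parity_simps, not_not])]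
        exact wordOf_bracket hn _ _
      · rw [cocycleBracketClass, dif_neg hn]
        rfl)

theorem cohomologyCup_cls {p q n : ℕ} (h : p + q = n) {f : HochschildCochain k A p}
    (hf : f ∈ cocycles k A p) {g : HochschildCochain k A q} (hg : g ∈ cocycles k A q) :
    cohomologyCup k A (HochschildCohomology.cls f hf) (HochschildCohomology.cls g hg) =
      HochschildCohomology.cls (cup h f g) (cup_mem_cocycles h hf hg) := by
  subst h
  exact bilinearExtension_cls _ _ _ f hf g hg

theorem cohomologyBracket_cls {p q n : ℕ} (h : p + q = n + 1) {f : HochschildCochain k A p}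
    (hf : f ∈ cocycles k A p) {g : HochschildCochain k A q} (hg : g ∈ cocycles k A q) :
    cohomologyBracket k A (HochschildCohomology.cls f hf) (HochschildCohomology.cls g hg) =
      HochschildCohomology.cls (bracket h f g) (bracket_mem_cocycles h hf hg) := by
  rw [cohomologyBracket, bilinearExtension_cls, cocycleBracketClass_eq h]
  rfl

theorem cohomologyBracket_cls_zero {f g : HochschildCochain k A 0}
    (hf : f ∈ cocycles k A 0) (hg : g ∈ cocycles k A 0) :
    cohomologyBracket k A (HochschildCohomology.cls f hf) (HochschildCohomology.cls g hg) = 0 := by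
  rw [cohomologyBracket, bilinearExtension_cls, cocycleBracketClass, dif_neg (by omega)]
  rfl

theorem wordComp_wordOf_zero (f : HochschildCochain k A 0) (G : List A → A) :
    wordComp (wordOf f) G = 0 := by
  ext w
  refine splitSum_eq_zero fun u x _ => splitSum_eq_zero fun v z _ => ?_
  rw [wordOf_of_ne _ (by simp), smul_zero]

namespace Represents

variable {p q : ℕ} {x y : ⨁ n, HochschildCohomology k A n} {F G : List A → A}

theorem zero : Represents (k := k) (A := A) p 0 0 := .inl ⟨rfl, rfl⟩

theorem cup (hF : Represents p x F) (hG : Represents q y G) :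
    Represents (p + q) (cohomologyCup k A x y) (wordCup F G) := by
  rcases hF with ⟨rfl, rfl⟩ | ⟨m, f, hf, rfl, rfl, hm⟩
  · rw [map_zero, LinearMap.zero_apply, zero_wordCup]
    exact .zero
  rcases hG with ⟨rfl, rfl⟩ | ⟨n, g, hg, rfl, rfl, hn⟩
  · rw [map_zero, wordCup_zero]
    exact .zero
  refine .inr ⟨m + n, _, _, cohomologyCup_cls rfl hf hg, (wordOf_cup rfl f g).symm, ?_⟩
  simp only [parity_simps, hm, hn]

theorem bracket (hF : Represents p x F) (hG : Represents q y G) :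
    Represents (p + q + 1) (cohomologyBracket k A x y) (wordBracket p q F G) := by
  rcases hF with ⟨rfl, rfl⟩ | ⟨m, f, hf, rfl, rfl, hm⟩
  · rw [map_zero, LinearMap.zero_apply, zero_wordBracket hG.multilinear]
    exact .zero
  rcases hG with ⟨rfl, rfl⟩ | ⟨n, g, hg, rfl, rfl, hn⟩
  · rw [map_zero, wordBracket_zero (wordMultilinear_wordOf f)]
    exact .zero
  rw [← wordBracket_congr hm hn]
  rcases h : m + n with _ | l
  -- Degree `-1` is covered by the zero alternative of `Represents`, and the word bracket of two
  -- functions of degree 0 is indeed 0.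
  · obtain ⟨rfl, rfl⟩ : m = 0 ∧ n = 0 := by omega
    refine .inl ⟨cohomologyBracket_cls_zero hf hg, ?_⟩
    rw [wordBracket, wordComp_wordOf_zero, wordComp_wordOf_zero, smul_zero, sub_zero]
  · refine .inr ⟨l, _, _, cohomologyBracket_cls h hf hg, (wordOf_bracket h f g).symm, ?_⟩
    have := congrArg Even h
    simp only [parity_simps, hm, hn] at this ⊢
    grind

end Represents

end Cohomology

/-! ### The Connes operator on cohomology and verification of the axioms -/

section Cohomology

open HochschildCochain

variable {k A : Type*} [CommRing k] [Ring A] [Algebra k A]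

theorem neg_one_pow_smul_eq_int {M : Type*} [AddCommGroup M] [Module k M] (n : ℕ) (x : M) :
    (-1 : k) ^ n • x = (-1 : ℤ) ^ n • x := by
  rw [← Int.cast_smul_eq_zsmul k]
  simp

theorem wordOf_cochainOf_eq {F : List A → A} (hF : WordMultilinear k F) {n : ℕ}
    (h : ∀ w, w.length ≠ n → F w = 0) : wordOf (cochainOf hF n) = F := by
  ext w
  by_cases hw : w.length = n
  · exact wordOf_cochainOf hF hw
  · rw [wordOf_of_ne _ hw, h w hw]

theorem wordComp_zero {F : List A → A} (hF : WordMultilinear k F) : wordComp F 0 = 0 := by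
  simpa using wordComp_ksmul hF 0 0

theorem zero_wordComp (f : List A → A) : wordComp (0 : List A → A) f = 0 := by
  simpa using ksmul_wordComp (0 : ℤ) (0 : List A → A) f

section Homogeneous

variable {V : ℕ → Type*} [∀ p, AddCommGroup (V p)] [∀ p, Module k (V p)]

/-- Taking the bracket for `mul` as well covers the Jacobi identity. -/
theorem leibniz_of_homogeneous (br mul : (⨁ p, V p) →ₗ[k] (⨁ p, V p) →ₗ[k] ⨁ p, V p)
    (x y : ⨁ p, V p) (c : k)
    (H : ∀ p z, br x (mul y (DirectSum.lof k ℕ V p z)) = mul (br x y) (DirectSum.lof k ℕ V p z) +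
      c • mul y (br x (DirectSum.lof k ℕ V p z))) (z : ⨁ p, V p) :
    br x (mul y z) = mul (br x y) z + c • mul y (br x z) := by
  have : br x ∘ₗ mul y = mul (br x y) + c • (mul y ∘ₗ br x) :=
    DirectSum.linearMap_ext _ fun p => LinearMap.ext fun z => H p z
  exact LinearMap.congr_fun this z

theorem bracket_eq_of_homogeneous (br mul : (⨁ p, V p) →ₗ[k] (⨁ p, V p) →ₗ[k] ⨁ p, V p)
    (B : (⨁ p, V p) →ₗ[k] ⨁ p, V p) (x : ⨁ p, V p) (c : k)
    (H : ∀ p y, br x (DirectSum.lof k ℕ V p y) = c • (B (mul x (DirectSum.lof k ℕ V p y)) -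
      mul (B x) (DirectSum.lof k ℕ V p y) - c • mul x (B (DirectSum.lof k ℕ V p y))))
    (y : ⨁ p, V p) : br x y = c • (B (mul x y) - mul (B x) y - c • mul x (B y)) := by
  have : br x = c • (B ∘ₗ mul x - mul (B x) - c • (mul x ∘ₗ B)) :=
    DirectSum.linearMap_ext _ fun p => LinearMap.ext fun z => H p z
  exact LinearMap.congr_fun this y

end Homogeneous

namespace IsSymmetrizingTrace

variable {tr : A →ₗ[k] k} (ht : IsSymmetrizingTrace tr)
include ht

theorem wordConnes_zero : wordConnes tr 0 = 0 :=
  ht.wordConnes_eq_zero .zero fun _ _ => rfl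

theorem wordOf_connes {n : ℕ} (f : HochschildCochain k A (n + 1)) :
    wordOf (cochainOf (ht.wordMultilinear_wordConnes (wordMultilinear_wordOf f)) n) =
      wordConnes tr (wordOf f) := by
  refine wordOf_cochainOf_eq _ fun w hw => ?_
  rw [ht.wordConnes_congr (wordMultilinear_wordOf f) .zero (g := 0) fun v hv => ?_,
    ht.wordConnes_zero, Pi.zero_apply]
  rw [wordOf_of_ne _ (by omega), Pi.zero_apply]

theorem wordDiff_wordConnes_eq_zero {F : List A → A} (hF : WordMultilinear k F)
    (h : wordDiff F = 0) : wordDiff (wordConnes tr F) = 0 := by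
  rw [ht.wordDiff_wordConnes hF hF.diff, h, ht.wordConnes_zero, neg_zero]

/-- The Connes operator on cocycles. -/
noncomputable def cocycleConnes (n : ℕ) : cocycles k A (n + 1) →ₗ[k] cocycles k A n where
  toFun f := ⟨cochainOf (ht.wordMultilinear_wordConnes (wordMultilinear_wordOf f.1)) n, by
    rw [mem_cocycles_iff, ht.wordOf_connes]
    exact ht.wordDiff_wordConnes_eq_zero (wordMultilinear_wordOf f.1) (mem_cocycles_iff.1 f.2)⟩
  map_add' f g := Subtype.ext <| wordOf_injective <| by
    refine (ht.wordOf_connes (f.1 + g.1)).trans (.trans ?_ (wordOf_add _ _).symm)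
    rw [wordOf_add, ht.wordConnes_add (wordMultilinear_wordOf f.1) (wordMultilinear_wordOf g.1)]
    exact congrArg₂ _ (ht.wordOf_connes f.1).symm (ht.wordOf_connes g.1).symm
  map_smul' c f := Subtype.ext <| wordOf_injective <| by
    refine (ht.wordOf_connes (c • f.1)).trans (.trans ?_ (wordOf_smul _ _).symm)
    rw [wordOf_smul, ht.wordConnes_smul (wordMultilinear_wordOf f.1) c
      ((wordMultilinear_wordOf f.1).smul c)]
    exact congrArg _ (ht.wordOf_connes f.1).symm

/-- The Connes operator on the cohomology of a given degree. -/
noncomputable def connesClass :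
    ∀ n, HochschildCohomology k A n →ₗ[k] ⨁ n, HochschildCohomology k A n
  | 0 => 0
  | n + 1 => Submodule.liftQ _ (classMap k A n ∘ₗ ht.cocycleConnes n) fun f hf => by
      refine classMap_eq_zero ?_
      obtain ⟨F, hF, hF', e⟩ := exists_of_mem_coboundaries (f := f.1) hf
      refine ⟨-wordConnes tr F, (ht.wordMultilinear_wordConnes hF).neg, ?_⟩
      rw [← neg_one_zsmul, wordDiff_smul, ht.wordDiff_wordConnes hF hF.diff, neg_one_zsmul, neg_neg,
        ← e]
      exact ht.wordOf_connes _

/-- The Connes operator on the total cohomology. -/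
noncomputable def cohomologyConnes :
    (⨁ n, HochschildCohomology k A n) →ₗ[k] ⨁ n, HochschildCohomology k A n :=
  DirectSum.toModule k ℕ _ ht.connesClass

theorem cohomologyConnes_represents {p : ℕ} {x : ⨁ n, HochschildCohomology k A n}
    {F : List A → A} (h : Represents p x F) :
    Represents (p + 1) (ht.cohomologyConnes x) (wordConnes tr F) := by
  rcases h with ⟨rfl, rfl⟩ | ⟨n, f, hf, rfl, rfl, hn⟩
  · rw [map_zero, ht.wordConnes_zero]
    exact .zero
  rw [HochschildCohomology.cls, cohomologyConnes, DirectSum.toModule_lof]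
  rcases n with _ | n
  · refine .inl ⟨rfl, ht.wordConnes_eq_zero (wordMultilinear_wordOf f) fun w hw => ?_⟩
    rw [wordOf_of_ne _ (by simpa using hw)]
  · refine .inr ⟨n, _, (ht.cocycleConnes n ⟨f, hf⟩).2, rfl, (ht.wordOf_connes f).symm, ?_⟩
    simp only [parity_simps] at hn ⊢
    grind

end IsSymmetrizingTrace

/-- The form in which every axiom holding only up to homotopy is proved; `H` is the homotopy. -/
theorem totalCohomologyWord_eq {x y : ⨁ n, HochschildCohomology k A n} {F G H : List A → A}
    (hx : totalCohomologyWord k A x = Submodule.Quotient.mk F)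
    (hy : totalCohomologyWord k A y = Submodule.Quotient.mk G)
    (hH : WordMultilinear k H) (h : F = G + wordDiff H) : x = y := by
  apply totalCohomologyWord_injective
  rw [hx, hy, Submodule.Quotient.eq]
  exact ⟨H, hH, by rw [h, add_sub_cancel_left]⟩

theorem totalCohomologyWord_add {x y : ⨁ n, HochschildCohomology k A n} {F G : List A → A}
    (hx : totalCohomologyWord k A x = Submodule.Quotient.mk F)
    (hy : totalCohomologyWord k A y = Submodule.Quotient.mk G) :
    totalCohomologyWord k A (x + y) = Submodule.Quotient.mk (F + G) := by
  rw [map_add, hx, hy, Submodule.Quotient.mk_add]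

theorem totalCohomologyWord_sub {x y : ⨁ n, HochschildCohomology k A n} {F G : List A → A}
    (hx : totalCohomologyWord k A x = Submodule.Quotient.mk F)
    (hy : totalCohomologyWord k A y = Submodule.Quotient.mk G) :
    totalCohomologyWord k A (x - y) = Submodule.Quotient.mk (F - G) := by
  rw [map_sub, hx, hy, Submodule.Quotient.mk_sub]

theorem totalCohomologyWord_neg_one_pow_smul {x : ⨁ n, HochschildCohomology k A n}
    {F : List A → A} (n : ℕ) (hx : totalCohomologyWord k A x = Submodule.Quotient.mk F) :
    totalCohomologyWord k A ((-1 : k) ^ n • x) = Submodule.Quotient.mk ((-1 : ℤ) ^ n • F) := by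
  rw [map_smul, hx, ← Submodule.Quotient.mk_smul, neg_one_pow_smul_eq_int]

theorem HochschildCochain.one_mem_cocycles : one k A ∈ cocycles k A 0 := by
  rw [mem_cocycles_iff, wordOf_one, wordDiff_wordOne]

variable (k A) in
theorem represents_one :
    Represents 0 (HochschildCohomology.cls (one k A) one_mem_cocycles) wordOne :=
  .inr ⟨0, one k A, one_mem_cocycles, rfl, wordOf_one.symm, Iff.rfl⟩

/-- Induction on the total cohomology, over classes represented by functions of words. -/
theorem total_induction {P : (⨁ n, HochschildCohomology k A n) → Prop} (h0 : P 0)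
    (hadd : ∀ x y, P x → P y → P (x + y))
    (h : ∀ n x F, Represents n x F → P x) (x) : P x := by
  induction x using DirectSum.induction_on with
  | zero => exact h0
  | add x y hx hy => exact hadd x y hx hy
  | of n x =>
    obtain ⟨F, hF⟩ := exists_represents n x
    exact h n _ F hF

variable (k A) in
/-- The Gerstenhaber algebra structure on Hochschild cohomology. -/
noncomputable def hochschildGerstenhaberAlgebra :
    GerstenhaberAlgebra k (HochschildCohomology k A) where
  mul := cohomologyCup k A
  one := HochschildCohomology.cls (one k A) one_mem_cocycles
  bracket := cohomologyBracket k A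
  one_mem := ⟨_, rfl⟩
  mul_mem p q a b := by
    obtain ⟨f, rfl⟩ := Submodule.Quotient.mk_surjective _ a
    obtain ⟨g, rfl⟩ := Submodule.Quotient.mk_surjective _ b
    exact ⟨_, (cohomologyCup_cls rfl f.2 g.2).symm⟩
  one_mul := total_induction (by simp) (fun x y hx hy => by rw [map_add, hx, hy])
    fun n x F hF => totalCohomologyWord_eq ((represents_one k A).cup hF).total_eq hF.total_eq .zero
      (by rw [wordOne_wordCup, wordDiff_zero, add_zero])
  mul_one := total_induction (by simp)
    (fun x y hx hy => by rw [map_add, LinearMap.add_apply, hx, hy])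
    fun n x F hF => totalCohomologyWord_eq (hF.cup (represents_one k A)).total_eq hF.total_eq .zero
      (by rw [wordCup_wordOne, wordDiff_zero, add_zero])
  mul_assoc := total_induction (by simp)
    (fun x y hx hy u v => by simp only [map_add, LinearMap.add_apply, hx, hy])
    fun m x F hF => total_induction (by simp)
      (fun x y hx hy v => by simp only [map_add, LinearMap.add_apply, hx, hy])
      fun n y G hG => total_induction (by simp) (fun x y hx hy => by simp only [map_add, hx, hy])
        fun l z H hH => totalCohomologyWord_eq ((hF.cup hG).cup hH).total_eq
          (hF.cup (hG.cup hH)).total_eq .zero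
          (by rw [wordCup_assoc, wordDiff_zero, add_zero])
  mul_comm p q a b := by
    obtain ⟨F, hF⟩ := exists_represents p a
    obtain ⟨G, hG⟩ := exists_represents q b
    refine totalCohomologyWord_eq (hF.cup hG).total_eq
      (totalCohomologyWord_neg_one_pow_smul _ (hG.cup hF).total_eq)
      -- For cocycles the differential of `F ∘ G` is the graded cup commutator up to this sign.
      ((hF.multilinear.comp hG.multilinear).zsmul ((-1 : ℤ) ^ (q + p * q + 1))) ?_
    have h := wordDiff_wordComp hF.parity hF.multilinear hG.parity
    rw [hF.diff_eq_zero, hG.diff_eq_zero, wordComp_zero hF.multilinear, zero_wordComp] at h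
    rw [wordDiff_smul, h]
    rcases neg_one_pow_eq_or ℤ p with h | h <;> rcases neg_one_pow_eq_or ℤ q with h' | h' <;>
      simp [pow_add, pow_mul, h, h']
  bracket_mem p q n h a b := by
    obtain ⟨f, rfl⟩ := Submodule.Quotient.mk_surjective _ a
    obtain ⟨g, rfl⟩ := Submodule.Quotient.mk_surjective _ b
    exact ⟨_, (cohomologyBracket_cls h f.2 g.2).symm⟩
  bracket_zero_zero a b := by
    obtain ⟨f, rfl⟩ := Submodule.Quotient.mk_surjective _ a
    obtain ⟨g, rfl⟩ := Submodule.Quotient.mk_surjective _ b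
    exact cohomologyBracket_cls_zero f.2 g.2
  bracket_skew p q a b := by
    obtain ⟨F, hF⟩ := exists_represents p a
    obtain ⟨G, hG⟩ := exists_represents q b
    apply totalCohomologyWord_injective
    rw [map_neg, (hF.bracket hG).total_eq,
      totalCohomologyWord_neg_one_pow_smul _ (hG.bracket hF).total_eq, wordBracket_skew,
      Submodule.Quotient.mk_neg]
  bracket_self p hp a := by
    obtain ⟨F, hF⟩ := exists_represents p a
    apply totalCohomologyWord_injective
    rw [(hF.bracket hF).total_eq, wordBracket_self hp, map_zero, Submodule.Quotient.mk_zero]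
  jacobi p q a b := by
    obtain ⟨F, hF⟩ := exists_represents p a
    obtain ⟨G, hG⟩ := exists_represents q b
    refine leibniz_of_homogeneous (V := HochschildCohomology k A) (cohomologyBracket k A)
      (cohomologyBracket k A) _ _ _ fun r z => ?_
    obtain ⟨H, hH⟩ := exists_represents r z
    refine totalCohomologyWord_eq (hF.bracket (hG.bracket hH)).total_eq
      (totalCohomologyWord_add ((hF.bracket hG).bracket hH).total_eq
        (totalCohomologyWord_neg_one_pow_smul _ (hG.bracket (hF.bracket hH)).total_eq)) .zero ?_
    rw [wordDiff_zero, add_zero]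
    exact wordBracket_jacobi hF.parity hF.multilinear hG.parity hG.multilinear hH.parity
      hH.multilinear
  jacobi_self p hp a := by
    obtain ⟨F, hF⟩ := exists_represents p a
    apply totalCohomologyWord_injective
    rw [(hF.bracket (hF.bracket hF)).total_eq,
      wordBracket_jacobi_self hp hF.parity hF.multilinear, map_zero, Submodule.Quotient.mk_zero]
  leibniz p q c a := by
    obtain ⟨F, hF⟩ := exists_represents p c
    obtain ⟨G, hG⟩ := exists_represents q a
    refine leibniz_of_homogeneous (V := HochschildCohomology k A) (cohomologyBracket k A)
      (cohomologyCup k A) _ _ _ fun r z => ?_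
    obtain ⟨H, hH⟩ := exists_represents r z
    refine totalCohomologyWord_eq (hF.bracket (hG.cup hH)).total_eq
      (totalCohomologyWord_add ((hF.bracket hG).cup hH).total_eq
        (totalCohomologyWord_neg_one_pow_smul _ (hG.cup (hF.bracket hH)).total_eq))
      ((hF.multilinear.brace hG.multilinear hH.multilinear).zsmul
        ((-1 : ℤ) ^ ((p + 1) * (q + r + 1) + q * r + r))) ?_
    rw [wordDiff_smul]
    exact wordDiff_wordBrace hF.parity hF.multilinear hG.parity hG.multilinear hH.parity
      hH.multilinear (hF.parity.brace hF.multilinear hG.parity hH.parity) hF.diff_eq_zero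
      hG.diff_eq_zero hH.diff_eq_zero

/-- The Batalin-Vilkovisky algebra structure on the Hochschild cohomology of a symmetric
algebra. -/
noncomputable def IsSymmetrizingTrace.batalinVilkoviskyAlgebra {tr : A →ₗ[k] k}
    (ht : IsSymmetrizingTrace tr) : BatalinVilkoviskyAlgebra k (HochschildCohomology k A) where
  toGerstenhaberAlgebra := hochschildGerstenhaberAlgebra k A
  B := ht.cohomologyConnes
  B_zero a := by
    rw [cohomologyConnes, DirectSum.toModule_lof]
    rfl
  B_mem p a := by
    obtain ⟨f, rfl⟩ := Submodule.Quotient.mk_surjective _ a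
    rw [cohomologyConnes, DirectSum.toModule_lof]
    exact ⟨_, rfl⟩
  B_B := total_induction (by simp) (fun x y hx hy => by simp only [map_add, hx, hy, add_zero])
    fun n x F hF => by
      have h := ht.cohomologyConnes_represents hF
      obtain ⟨G, hG, e⟩ := exists_wordComp_wordOne h.parity h.multilinear h.diff_eq_zero
      refine totalCohomologyWord_eq (ht.cohomologyConnes_represents h).total_eq
        (Represents.zero (p := 0)).total_eq hG.neg ?_
      rw [ht.wordConnes_wordConnes hF.multilinear, e, zero_add, ← neg_one_zsmul G, wordDiff_smul,
        neg_one_zsmul]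
  bracket_eq p a := by
    obtain ⟨F, hF⟩ := exists_represents p a
    refine bracket_eq_of_homogeneous (V := HochschildCohomology k A) (cohomologyBracket k A)
      (cohomologyCup k A) ht.cohomologyConnes _ _ fun q y => ?_
    obtain ⟨G, hG⟩ := exists_represents q y
    have hBF := ht.cohomologyConnes_represents hF
    have hBG := ht.cohomologyConnes_represents hG
    have h1 := ht.wordConnes_wordCup hF.multilinear hG.multilinear hF.parity hG.parity
      hF.diff_eq_zero hG.diff_eq_zero
    -- This commutes `ΔG` past `F`, as needed to turn `ΔG ⌣ F` into `F ⌣ ΔG`.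
    have h2 := wordDiff_wordComp hF.parity hF.multilinear hBG.parity
    rw [hF.diff_eq_zero, hBG.diff_eq_zero, wordComp_zero hF.multilinear, zero_wordComp] at h2
    refine totalCohomologyWord_eq (hF.bracket hG).total_eq
      (totalCohomologyWord_neg_one_pow_smul _ (totalCohomologyWord_sub (totalCohomologyWord_sub
        (ht.cohomologyConnes_represents (hF.cup hG)).total_eq (hBF.cup hG).total_eq)
        (totalCohomologyWord_neg_one_pow_smul _ (hF.cup hBG).total_eq)))
      -- The first term is the commutation homotopy for `F` and `ΔG`; the other two are the
      -- homotopies of the two halves of `Δ(F ⌣ G)`.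
      (H := (-1 : ℤ) ^ (p * q + q + p) • wordComp F (wordConnes tr G) -
        ((-1 : ℤ) ^ (p * q + p) • wordBVHomotopy tr F G +
          (-1 : ℤ) ^ p • wordBVHomotopy tr G F))
      (((hF.multilinear.comp hBG.multilinear).zsmul _).sub
        (((ht.wordMultilinear_wordBVHomotopy hF.multilinear hG.multilinear).zsmul _).add
          ((ht.wordMultilinear_wordBVHomotopy hG.multilinear hF.multilinear).zsmul _))) ?_
    simp only [sub_eq_add_neg, ← neg_one_zsmul (_ + _), wordDiff_add, wordDiff_smul, h1, h2,
      wordBracket]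
    rcases neg_one_pow_eq_or ℤ p with h | h <;> rcases neg_one_pow_eq_or ℤ q with h' | h' <;>
      simp [pow_add, pow_mul, h, h'] <;> abel

end Cohomology

theorem corollary6p2 {k A : Type*} [CommRing k] [Ring A] [Algebra k A]
    (hA : AlgebraIsSymmetric k A) :
    ∃ S : BatalinVilkoviskyAlgebra k (HochschildCohomology k A),
      (∃ h : HochschildCochain.one k A ∈ HochschildCochain.cocycles k A 0,
        S.one = HochschildCohomology.cls (HochschildCochain.one k A) h) ∧
      (∀ (p q n : ℕ) (hn : p + q = n) (f : HochschildCochain k A p) (g : HochschildCochain k A q)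
        (hf : f ∈ HochschildCochain.cocycles k A p) (hg : g ∈ HochschildCochain.cocycles k A q),
        ∃ h : HochschildCochain.cup hn f g ∈ HochschildCochain.cocycles k A n,
          S.mul (HochschildCohomology.cls f hf) (HochschildCohomology.cls g hg) =
            HochschildCohomology.cls (HochschildCochain.cup hn f g) h) ∧
      (∀ (p q n : ℕ) (hn : p + q = n + 1) (f : HochschildCochain k A p)
        (g : HochschildCochain k A q)
        (hf : f ∈ HochschildCochain.cocycles k A p) (hg : g ∈ HochschildCochain.cocycles k A q),
        ∃ h : HochschildCochain.bracket hn f g ∈ HochschildCochain.cocycles k A n,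
          S.bracket (HochschildCohomology.cls f hf) (HochschildCohomology.cls g hg) =
            HochschildCohomology.cls (HochschildCochain.bracket hn f g) h) := by
  obtain ⟨tr, ht⟩ := hA.exists_trace
  exact ⟨ht.batalinVilkoviskyAlgebra, ⟨HochschildCochain.one_mem_cocycles, rfl⟩,
    fun p q n hn f g hf hg => ⟨_, cohomologyCup_cls hn hf hg⟩,
    fun p q n hn f g hf hg => ⟨_, cohomologyBracket_cls hn hf hg⟩⟩
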